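/- Let $g\ge 3$ and let $S_g$ be the closed connected orientable surface of genus $g$. A filling pair $(\alpha,\beta)$ on $S_g$ is a pair of simple closed curves in minimal position (they cross transversally and realize the geometric intersection number $i(\alpha,\beta)$, the minimum over isotopic representatives) such that every component of $S_g\setminus(\alpha\cup\beta)$ is an open disk. It is minimally intersecting if $i(\alpha,\beta)$ is minimal among all filling pairs on $S_g$, and coherent if the absolute value of the algebraic intersection number of $\alpha$ and $\beta$ equals $i(\alpha,\beta)$. Let $(\alpha,\beta)$ be a coherent minimally intersecting filling pair on $S_g$. Consider the $4(2g-1)$-gon obtained by cutting $S_g$ open along $\alpha\cup\beta$; its sides correspond to the subarcs into which $\alpha$ and $\beta$ cut each other, and two different sides are identified if they come from the same subarc. Let $a_1,\dots,a_{2(2g-1)}$ be its sides coming from $\alpha$, in clockwise order, and put $$d(a_i,a_j)=\begin{cases}|i-j|, & |i-j|\le 2g-1,\\ 2(2g-1)-|i-j|, & |i-j|>2g-1.\end{cases}$$ Then, whenever $a_i$ and $a_j$ ($i\ne j$) are identified, $d(a_i,a_j)$ is odd and $d(a_i,a_j)\ne 1$. -/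

import Mathlib

open scoped Manifold ContDiff

noncomputable section

namespace FillingPairs

universe u

/-- The Euclidean plane, on which the charts of a surface take their values. -/
abbrev Plane : Type := EuclideanSpace ℝ (Fin 2)

/-- The determinant of the matrix whose columns are the plane vectors `v` and `w`. -/
def det2 (v w : Plane) : ℝ := v 0 * w 1 - v 1 * w 0

/-- The atlas of the surface `S` is an oriented atlas: all changes of charts have a positive
Jacobian determinant. A smooth surface is orientable iff its smooth structure is given by
such an atlas, and the atlas then fixes an orientation. -/
class HasOrientedAtlas (S : Type u) [TopologicalSpace S] [ChartedSpace Plane S] : Prop where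
  det_pos : ∀ e ∈ atlas Plane S, ∀ e' ∈ atlas Plane S, ∀ x ∈ (e.symm.trans e').source,
    0 < (fderiv ℝ (e.symm.trans e') x).det

/-- First singular homology with rational coefficients. -/
abbrev H1 (S : Type u) [TopologicalSpace S] : ModuleCat.{u} ℚ :=
  ((AlgebraicTopology.singularHomologyFunctor (ModuleCat.{u} ℚ) 1).obj
    (ModuleCat.of ℚ (ULift.{u} ℚ))).obj (TopCat.of S)

/-- A closed connected orientable surface has genus `g` iff its first Betti number is `2 * g`. -/
def HasGenus (S : Type u) [TopologicalSpace S] (g : ℕ) : Prop :=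
  Module.Finite ℚ (H1 S) ∧ Module.finrank ℚ (H1 S) = 2 * g

section Curves

variable (S : Type u) [TopologicalSpace S] [ChartedSpace Plane S]

/-- A smooth simple closed curve: a smooth regular map `ℝ → S` of period `1` that is injective
modulo the period. -/
structure SimpleClosedCurve where
  toFun : ℝ → S
  contMDiff : ContMDiff 𝓘(ℝ, ℝ) (𝓡 2) ∞ toFun
  periodic : Function.Periodic toFun 1
  injective_mod : ∀ s t : ℝ, toFun s = toFun t → ∃ n : ℤ, s - t = n
  regular : ∀ t : ℝ, Function.Injective (mfderiv 𝓘(ℝ, ℝ) (𝓡 2) toFun t)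

variable {S}

instance : CoeFun (SimpleClosedCurve S) (fun _ => ℝ → S) := ⟨SimpleClosedCurve.toFun⟩

namespace SimpleClosedCurve

/-- The point set of the curve. -/
def image (γ : SimpleClosedCurve S) : Set S := Set.range γ.toFun

/-- The velocity of `γ` at time `t`, in the preferred chart at the point `γ t`. -/
def velocity (γ : SimpleClosedCurve S) (t : ℝ) : Plane :=
  mfderiv 𝓘(ℝ, ℝ) (𝓡 2) γ.toFun t (1 : ℝ)

/-- Two simple closed curves are isotopic if they are joined by a continuous family of
simple closed curves. -/
def Isotopic (γ γ' : SimpleClosedCurve S) : Prop :=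
  ∃ H : unitInterval → SimpleClosedCurve S,
    Continuous (fun p : unitInterval × ℝ => H p.1 p.2) ∧ H 0 = γ ∧ H 1 = γ'

end SimpleClosedCurve

open SimpleClosedCurve

/-- The geometric intersection number `i(α, β)`: the minimal number of intersection points over
all isotopic representatives. -/
def geomInt (α β : SimpleClosedCurve S) : ℕ∞ :=
  ⨅ (α' : SimpleClosedCurve S) (_ : Isotopic α α') (β' : SimpleClosedCurve S)
    (_ : Isotopic β β'), (α'.image ∩ β'.image).encard

/-- The curves cross transversally at each common point. -/
def Transverse (α β : SimpleClosedCurve S) : Prop :=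
  ∀ s t : ℝ, α s = β t → det2 (α.velocity s) (β.velocity t) ≠ 0

/-- Transverse curves that realize their geometric intersection number. -/
def MinimalPosition (α β : SimpleClosedCurve S) : Prop :=
  Transverse α β ∧ (α.image ∩ β.image).encard = geomInt α β

/-- The algebraic intersection number (of the curves oriented by their parametrizations, on the
surface oriented by its atlas): the sum of the signs of the crossings. Each common point is
met exactly once, through its two parameters in `[0, 1)`. -/
def algInt (α β : SimpleClosedCurve S) : ℤ :=
  ∑ᶠ (p : ℝ × ℝ) (_ : p ∈ {p : ℝ × ℝ | p.1 ∈ Set.Ico 0 1 ∧ p.2 ∈ Set.Ico 0 1 ∧ α p.1 = β p.2}),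
    (SignType.sign (det2 (α.velocity p.1) (β.velocity p.2)) : ℤ)

/-- A filling pair: two simple closed curves in minimal position such that every component of the
complement of their union is an open disk. -/
def IsFillingPair (α β : SimpleClosedCurve S) : Prop :=
  MinimalPosition α β ∧
    ∀ x ∈ (α.image ∪ β.image)ᶜ,
      Nonempty (connectedComponentIn (α.image ∪ β.image)ᶜ x ≃ₜ Metric.ball (0 : ℂ) 1)

/-- A filling pair whose intersection number is minimal among all filling pairs on `S`. -/
def IsMinimallyIntersecting (α β : SimpleClosedCurve S) : Prop :=
  IsFillingPair α β ∧
    ∀ α' β' : SimpleClosedCurve S, IsFillingPair α' β' → geomInt α β ≤ geomInt α' β'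

/-- The absolute value of the algebraic intersection number equals the geometric intersection
number. -/
def IsCoherent (α β : SimpleClosedCurve S) : Prop :=
  ((algInt α β).natAbs : ℕ∞) = geomInt α β

/-- `A` is one of the open subarcs into which the points of `β` cut the curve `α`, that is, a
connected component of `α \ β`. -/
def IsSubarc (α β : SimpleClosedCurve S) (A : Set S) : Prop :=
  ∃ x ∈ α.image \ β.image, A = connectedComponentIn (α.image \ β.image) x

end Curves

/-- The vertices of the regular `N`-gon in the complex plane, in clockwise order. -/
def vertex (N k : ℕ) : ℂ := Complex.exp (-(2 * Real.pi * Complex.I * k / N))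

/-- The closed regular `N`-gon. -/
def polygon (N : ℕ) : Set ℂ := convexHull ℝ (Set.range (vertex N))

/-- The `k`-th side of the `N`-gon (without its end points), the sides being numbered in clockwise
order. -/
def side (N : ℕ) (k : Fin N) : Set ℂ := openSegment ℝ (vertex N k) (vertex N (k + 1))

/-- A presentation of `S` as an `N`-gon with glued sides, cut open along `α ∪ β`: a map of the
closed polygon to `S`, `C¹` with invertible derivative up to the boundary, that takes the interior
bijectively to the complement of `α ∪ β` and each side bijectively to a subarc of
`α` or of `β`. In particular the complement of `α ∪ β` is a single disk. -/
structure CutPolygon {S : Type u} [TopologicalSpace S] [ChartedSpace Plane S]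
    (α β : SimpleClosedCurve S) (N : ℕ) where
  toFun : ℂ → S
  contMDiffOn : ContMDiffOn 𝓘(ℝ, ℂ) (𝓡 2) 1 toFun (polygon N)
  regular : ∀ z ∈ polygon N,
    Function.Injective (mfderivWithin 𝓘(ℝ, ℂ) (𝓡 2) toFun (polygon N) z)
  bijOn_interior : Set.BijOn toFun (interior (polygon N)) (α.image ∪ β.image)ᶜ
  injOn_side : ∀ k : Fin N, Set.InjOn toFun (side N k)
  side_subarc : ∀ k : Fin N,
    IsSubarc α β (toFun '' side N k) ∨ IsSubarc β α (toFun '' side N k)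

namespace CutPolygon

variable {S : Type u} [TopologicalSpace S] [ChartedSpace Plane S]
  {α β : SimpleClosedCurve S} {N : ℕ}

/-- The `k`-th side is an `α`-edge: it comes from a subarc of `α`. -/
def IsAlphaEdge (P : CutPolygon α β N) (k : Fin N) : Prop :=
  IsSubarc α β (P.toFun '' side N k)

/-- Two sides are identified if they come from the same subarc. -/
def Identified (P : CutPolygon α β N) (k l : Fin N) : Prop :=
  k ≠ l ∧ P.toFun '' side N k = P.toFun '' side N l

end CutPolygon

/-- The cyclic distance of two of the indices `0, …, 2 * n - 1`. -/
def cyclicDist (n : ℕ) (i j : Fin (2 * n)) : ℕ :=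
  if ((i : ℤ) - j).natAbs ≤ n then ((i : ℤ) - j).natAbs
  else 2 * n - ((i : ℤ) - j).natAbs

end FillingPairs

end

/-! Coherence makes all crossings have the same sign: the sum of the signs has absolute value equal
to the number of crossings (`exists_crossing_sign`). Each polygon side runs forwards or backwards
along its curve. At a corner, the directions of the two sides, the sign of the crossing and the
orientation of the polygon map determine each other (`mul_sign_det2`). The map preserves orientation
everywhere or nowhere (`sign_jac_tangentWithin_eq`), and sides on `α` and `β` alternate. From an
`α`-side to the next, the corners are of type (α, β) and (β, α), which flips the sign once, so the
`α`-sides run alternately forwards and backwards (`direction_add_two`).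

Identified sides run in opposite directions: otherwise the polygon would lie on the same side of the
arc along both and the map would not be injective inside (`mul_nonpos_of_edge_parallel`). Hence
their indices have different parity, and the cyclic distance is odd because the number of `α`-sides
is even.

If consecutive `α`-sides were identified, the second would start on the surface where the first
ends. The `β`-side between them would be a closed loop, hence all of `β` but one point, so all
`β`-sides would be identified. Two of them that are two `β`-steps apart contradict the parity
statement for the swapped pair (`image_ne_image_add_two`). -/

namespace FillingPairs

/-! ### Plane geometry of the regular polygon -/

/-- The cross product of two complex numbers, seen as plane vectors. -/
def cross (u w : ℂ) : ℝ := u.re * w.im - u.im * w.re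

lemma vertex_re (N k : ℕ) : (vertex N k).re = Real.cos (2 * Real.pi * k / N) := by
  have : (-(2 * Real.pi * Complex.I * k / N) : ℂ)
      = ((-(2 * Real.pi * k / N) : ℝ) : ℂ) * Complex.I := by push_cast; ring
  rw [vertex, this, Complex.exp_ofReal_mul_I_re, Real.cos_neg]

lemma vertex_im (N k : ℕ) : (vertex N k).im = -Real.sin (2 * Real.pi * k / N) := by
  have : (-(2 * Real.pi * Complex.I * k / N) : ℂ)
      = ((-(2 * Real.pi * k / N) : ℝ) : ℂ) * Complex.I := by push_cast; ring
  rw [vertex, this, Complex.exp_ofReal_mul_I_im, Real.sin_neg]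

lemma cross_vertex (N i j : ℕ) :
    cross (vertex N i) (vertex N j) = -Real.sin (2 * Real.pi * (j - i) / N) := by
  have : (2 * Real.pi * (j - i) / N : ℝ) = 2 * Real.pi * j / N - 2 * Real.pi * i / N := by ring
  rw [this, Real.sin_sub, cross, vertex_re, vertex_re, vertex_im, vertex_im]
  ring

lemma vertex_add_period {N : ℕ} (hN : N ≠ 0) (k : ℕ) : vertex N (k + N) = vertex N k := by
  have hN' : (N : ℝ) ≠ 0 := by exact_mod_cast hN
  have : (2 * Real.pi * ((k + N : ℕ) : ℝ) / N : ℝ) = 2 * Real.pi * k / N + 2 * Real.pi := by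
    push_cast; field_simp
  apply Complex.ext
  · rw [vertex_re, vertex_re, this, Real.cos_add_two_pi]
  · rw [vertex_im, vertex_im, this, Real.sin_add_two_pi]

lemma vertex_mod {N : ℕ} (hN : N ≠ 0) (k : ℕ) : vertex N (k % N) = vertex N k := by
  have h : ∀ q r : ℕ, vertex N (r + N * q) = vertex N r := by
    intro q
    induction q with
    | zero => simp
    | succ q ih => intro r; rw [Nat.mul_succ, ← add_assoc, vertex_add_period hN, ih]
  conv_rhs => rw [← Nat.mod_add_div k N, h]

/-- The edge vector of the `k`-th side of the `N`-gon, with `k` taken modulo `N`. -/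
noncomputable def edge (N k : ℕ) : ℂ := vertex N (k + 1) - vertex N k

/-- The `k`-th open side of the `N`-gon, with `k` taken modulo `N`. -/
def openSide (N k : ℕ) : Set ℂ := openSegment ℝ (vertex N k) (vertex N (k + 1))

lemma side_eq_openSide (N : ℕ) (k : Fin N) : side N k = openSide N k := rfl

lemma openSide_mod {N : ℕ} (hN : N ≠ 0) (k : ℕ) : openSide N (k % N) = openSide N k := by
  rw [openSide, openSide, vertex_mod hN, ← vertex_mod hN (k % N + 1), Nat.mod_add_mod,
    vertex_mod hN]

/-- The point at time `t` of the `k`-th side. -/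
noncomputable def sidePoint (N k : ℕ) (t : ℝ) : ℂ := vertex N k + t • edge N k

lemma sidePoint_zero (N k : ℕ) : sidePoint N k 0 = vertex N k := by simp [sidePoint]

lemma sidePoint_one (N k : ℕ) : sidePoint N k 1 = vertex N (k + 1) := by simp [sidePoint, edge]

lemma openSide_eq_image (N k : ℕ) : openSide N k = sidePoint N k '' Set.Ioo 0 1 := by
  rw [openSide, openSegment_eq_image']
  rfl

lemma sidePoint_eq_combo (N k : ℕ) (t : ℝ) :
    sidePoint N k t = (1 - t) • vertex N k + t • vertex N (k + 1) := by
  rw [sidePoint, edge]; module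

lemma hasDerivAt_sidePoint (N k : ℕ) (t : ℝ) : HasDerivAt (sidePoint N k) (edge N k) t := by
  have := ((hasDerivAt_id t).smul_const (edge N k)).const_add (vertex N k)
  rwa [one_smul] at this

lemma continuous_sidePoint (N k : ℕ) : Continuous (sidePoint N k) :=
  continuous_iff_continuousAt.2 fun t => (hasDerivAt_sidePoint N k t).continuousAt

lemma vertex_mem_polygon {N : ℕ} (k : ℕ) : vertex N k ∈ polygon N :=
  subset_convexHull ℝ _ ⟨k, rfl⟩

lemma convex_polygon (N : ℕ) : Convex ℝ (polygon N) := convex_convexHull ℝ _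

lemma sidePoint_mem_polygon {N k : ℕ} {t : ℝ} (ht : t ∈ Set.Icc (0 : ℝ) 1) :
    sidePoint N k t ∈ polygon N := by
  rw [sidePoint_eq_combo]
  exact convex_polygon N (vertex_mem_polygon k) (vertex_mem_polygon (k + 1))
    (by linarith [ht.2]) ht.1 (by ring)

lemma sin_pos_of_lt_half {N k : ℕ} (hk : 0 < k) (hkN : 2 * k < N) :
    0 < Real.sin (2 * Real.pi * k / N) := by
  have hN : (0 : ℝ) < N := by exact_mod_cast (by omega : 0 < N)
  have hk' : (0 : ℝ) < k := by exact_mod_cast hk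
  have hkN' : (2 * k : ℝ) < N := by exact_mod_cast hkN
  refine Real.sin_pos_of_pos_of_lt_pi (by positivity) ?_
  rw [div_lt_iff₀ hN]
  nlinarith [Real.pi_pos]

lemma sin_nonneg_of_le_half {N k : ℕ} (hN : 0 < N) (hkN : 2 * k ≤ N) :
    0 ≤ Real.sin (2 * Real.pi * k / N) := by
  have hN : (0 : ℝ) < N := by exact_mod_cast hN
  have hkN' : (2 * k : ℝ) ≤ N := by exact_mod_cast hkN
  refine Real.sin_nonneg_of_nonneg_of_le_pi (by positivity) ?_
  rw [div_le_iff₀ hN]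
  nlinarith [Real.pi_pos]

lemma cross_add_left (u v w : ℂ) : cross (u + v) w = cross u w + cross v w := by
  simp [cross]; ring

lemma cross_smul_left (a : ℝ) (u w : ℂ) : cross (a • u) w = a * cross u w := by
  simp [cross]; ring

lemma cross_vertex_succ_neg {N : ℕ} (hN : 3 ≤ N) (k : ℕ) :
    cross (vertex N k) (vertex N (k + 1)) < 0 := by
  have := sin_pos_of_lt_half (N := N) (k := 1) one_pos (by omega)
  rw [cross_vertex]
  push_cast at *
  simpa using this

/-- With `η` the central angle of a side, the product is `-2 sin η (1 - cos η)`. The sign says that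
the clockwise boundary turns right. -/
lemma cross_edge_neg {N : ℕ} (hN : 3 ≤ N) (k : ℕ) : cross (edge N k) (edge N (k + 1)) < 0 := by
  have h := sin_pos_of_lt_half (N := N) (k := 1) one_pos (by omega)
  set η : ℝ := 2 * Real.pi * (1 : ℕ) / N with hη
  have h01 : cross (vertex N k) (vertex N (k + 1)) = -Real.sin η := by
    rw [cross_vertex, hη]; push_cast; ring_nf
  have h12 : cross (vertex N (k + 1)) (vertex N (k + 1 + 1)) = -Real.sin η := by
    rw [cross_vertex, hη]; push_cast; ring_nf
  have h02 : cross (vertex N k) (vertex N (k + 1 + 1)) = -(2 * Real.sin η * Real.cos η) := by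
    rw [← Real.sin_two_mul, cross_vertex, hη]; push_cast; ring_nf
  have hc : Real.cos η < 1 := by
    refine lt_of_le_of_ne (Real.cos_le_one η) fun hc => ?_
    have := Real.sin_sq_add_cos_sq η
    rw [hc] at this
    nlinarith
  have : cross (edge N k) (edge N (k + 1)) = cross (vertex N (k + 1)) (vertex N (k + 1 + 1))
      - cross (vertex N k) (vertex N (k + 1 + 1)) + cross (vertex N k) (vertex N (k + 1)) := by
    simp only [cross, edge, Complex.sub_re, Complex.sub_im]; ring
  rw [this, h01, h12, h02]
  nlinarith

lemma edge_ne_zero {N : ℕ} (hN : 3 ≤ N) (k : ℕ) : edge N k ≠ 0 := by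
  intro h
  have := cross_edge_neg hN k
  simp [h, cross] at this

/-- The line through the centre and `vertex N (k + 1)` separates the two sides: `cross · (vertex N
(k + 1))` is negative on side `k` and nonnegative on a side that begins and ends within the next
half turn. -/
lemma disjoint_openSide_of_lt {N k l : ℕ} (hN : 3 ≤ N) (hkl : k < l) (hl : 2 * (l - k) ≤ N) :
    Disjoint (openSide N k) (openSide N l) := by
  rw [Set.disjoint_left]
  rintro z ⟨a, b, ha, hb, -, rfl⟩ ⟨c, d, hc, hd, -, h⟩
  have h1 := congrArg (fun x => cross x (vertex N (k + 1))) h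
  simp only [cross_add_left, cross_smul_left] at h1
  obtain ⟨m, rfl⟩ : ∃ m, l = k + (m + 1) := ⟨l - k - 1, by omega⟩
  have e1 : cross (vertex N (k + (m + 1))) (vertex N (k + 1))
      = Real.sin (2 * Real.pi * m / N) := by
    rw [cross_vertex, ← Real.sin_neg]; push_cast; ring_nf
  have e2 : cross (vertex N (k + (m + 1) + 1)) (vertex N (k + 1))
      = Real.sin (2 * Real.pi * ((m + 1 : ℕ) : ℝ) / N) := by
    rw [cross_vertex, ← Real.sin_neg]; push_cast; ring_nf
  have e3 : cross (vertex N (k + 1)) (vertex N (k + 1)) = 0 := by simp [cross]; ring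
  have p1 := sin_nonneg_of_le_half (N := N) (k := m) (by omega) (by omega)
  have p2 := sin_nonneg_of_le_half (N := N) (k := m + 1) (by omega) (by omega)
  rw [e1, e2, e3, mul_zero, add_zero] at h1
  have := mul_neg_of_pos_of_neg ha (cross_vertex_succ_neg hN k)
  have := mul_nonneg hc.le p1
  have := mul_nonneg hd.le p2
  linarith

lemma disjoint_openSide {N k l : ℕ} (hN : 3 ≤ N) (hkl : k % N ≠ l % N) :
    Disjoint (openSide N k) (openSide N l) := by
  have h0 : N ≠ 0 := by omega
  wlog h : k % N < l % N generalizing k l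
  · exact (this hkl.symm (by omega)).symm
  have hl := Nat.mod_lt l (show N > 0 by omega)
  rcases le_or_gt (2 * (l % N - k % N)) N with h2 | h2
  · rw [← openSide_mod h0 k, ← openSide_mod h0 l]
    exact disjoint_openSide_of_lt hN h h2
  -- More than half a turn one way is less than half a turn the other way, so side `k` is taken one
  -- period later.
  · have e : openSide N k = openSide N (k % N + N) := by
      rw [← openSide_mod h0 (k % N + N), Nat.add_mod_right, Nat.mod_mod, openSide_mod h0]
    rw [← openSide_mod h0 l, e]
    exact (disjoint_openSide_of_lt hN (by omega) (by omega)).symm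

/-- When 4 divides the number of sides, `±1` and `±I` are vertices, and their hull contains the ball
of radius `1 / 2`. -/
lemma zero_mem_interior_polygon {m : ℕ} (hm : 0 < m) : (0 : ℂ) ∈ interior (polygon (4 * m)) := by
  have hm' : (m : ℝ) ≠ 0 := by exact_mod_cast hm.ne'
  have v0 : (1 : ℂ) ∈ polygon (4 * m) := by
    convert vertex_mem_polygon (N := 4 * m) 0
    simp [vertex]
  have v1 : (-Complex.I : ℂ) ∈ polygon (4 * m) := by
    convert vertex_mem_polygon (N := 4 * m) m
    have : (2 * Real.pi * (m : ℝ) / ((4 * m : ℕ) : ℝ)) = Real.pi / 2 := by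
      push_cast; field_simp; norm_num
    apply Complex.ext
    · rw [vertex_re, this]; simp
    · rw [vertex_im, this]; simp
  have v2 : (-1 : ℂ) ∈ polygon (4 * m) := by
    convert vertex_mem_polygon (N := 4 * m) (2 * m)
    have : (2 * Real.pi * ((2 * m : ℕ) : ℝ) / ((4 * m : ℕ) : ℝ)) = Real.pi := by
      push_cast; field_simp; norm_num
    apply Complex.ext
    · rw [vertex_re, this]; simp
    · rw [vertex_im, this]; simp
  have v3 : (Complex.I : ℂ) ∈ polygon (4 * m) := by
    convert vertex_mem_polygon (N := 4 * m) (3 * m)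
    have : (2 * Real.pi * ((3 * m : ℕ) : ℝ) / ((4 * m : ℕ) : ℝ)) = Real.pi / 2 + Real.pi := by
      push_cast; field_simp; norm_num
    apply Complex.ext
    · rw [vertex_re, this]; simp [Real.cos_add_pi]
    · rw [vertex_im, this]; simp [Real.sin_add_pi]
  have hc := convex_polygon (4 * m)
  have hx : ∀ x : ℝ, |x| ≤ 1 → (x : ℂ) ∈ polygon (4 * m) := by
    intro x hx
    obtain ⟨h1, h2⟩ := abs_le.1 hx
    convert hc v0 v2 (a := (1 + x) / 2) (b := (1 - x) / 2) (by linarith) (by linarith) (by ring)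
      using 1
    apply Complex.ext <;> simp
    ring
  have hy : ∀ y : ℝ, |y| ≤ 1 → (y * Complex.I : ℂ) ∈ polygon (4 * m) := by
    intro x hx
    obtain ⟨h1, h2⟩ := abs_le.1 hx
    convert hc v3 v1 (a := (1 + x) / 2) (b := (1 - x) / 2) (by linarith) (by linarith) (by ring)
      using 1
    apply Complex.ext <;> simp
    ring
  rw [mem_interior_iff_mem_nhds, Metric.mem_nhds_iff]
  refine ⟨1 / 2, by norm_num, fun z hz => ?_⟩
  rw [mem_ball_zero_iff] at hz
  have h1 := Complex.abs_re_le_norm z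
  have h2 := Complex.abs_im_le_norm z
  convert hc (hx (2 * z.re) (by rw [abs_mul, abs_two]; linarith))
    (hy (2 * z.im) (by rw [abs_mul, abs_two]; linarith))
    (a := 1 / 2) (b := 1 / 2) (by norm_num) (by norm_num) (by norm_num) using 1
  apply Complex.ext <;> simp

/-- At a point of a side, all directions to the right of the side enter the interior. -/
lemma exists_add_smul_mem_interior {N : ℕ} (hN : 3 ≤ N) (h0 : (0 : ℂ) ∈ interior (polygon N))
    {k : ℕ} {t : ℝ} (ht : t ∈ Set.Ioo (0 : ℝ) 1) {u : ℂ} (hu : cross (edge N k) u < 0) :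
    ∃ s : ℝ, 0 < s ∧ sidePoint N k t + s • u ∈ interior (polygon N) := by
  set z := sidePoint N k t with hz
  set τ := edge N k with hτ
  have hcz : 0 < cross τ z := by
    have h := cross_vertex_succ_neg hN k
    have : cross τ z = -cross (vertex N k) (vertex N (k + 1)) := by
      simp only [hτ, hz, sidePoint, cross, edge, Complex.sub_re, Complex.sub_im, Complex.add_re,
        Complex.add_im, Complex.smul_re, Complex.smul_im, smul_eq_mul]
      ring
    linarith
  -- These are the coordinates in `u = x • τ - y • z`, with `y > 0`. Moving by `s • u` therefore
  -- slides along the side to time `t + s * x / (1 - s * y)` and then shrinks towards the interior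
  -- point `0` by the factor `1 - s * y`.
  set y : ℝ := -cross τ u / cross τ z with hy
  set x : ℝ := cross u z / cross τ z with hx
  have hypos : 0 < y := div_pos (by linarith) hcz
  have hu' : u = x • τ - y • z := by
    have hne := hcz.ne'
    apply Complex.ext
    · simp only [hx, hy, Complex.sub_re, Complex.smul_re, smul_eq_mul]
      field_simp
      simp only [cross]; ring
    · simp only [hx, hy, Complex.sub_im, Complex.smul_im, smul_eq_mul]
      field_simp
      simp only [cross]; ring
  have hlim : Filter.Tendsto (fun s : ℝ => t + s * x / (1 - s * y)) (nhds 0) (nhds t) := by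
    have : ContinuousAt (fun s : ℝ => t + s * x / (1 - s * y)) 0 := by
      refine continuousAt_const.add (ContinuousAt.div (by fun_prop) (by fun_prop) (by simp))
    simpa [ContinuousAt] using this
  have hlim2 : Filter.Tendsto (fun s : ℝ => s * y) (nhds 0) (nhds 0) := by
    have : Continuous (fun s : ℝ => s * y) := by fun_prop
    simpa using this.tendsto 0
  have hev := (hlim.eventually (Ioo_mem_nhds ht.1 ht.2)).and
    (hlim2.eventually (gt_mem_nhds one_pos))
  obtain ⟨s, ⟨hs1, hs2⟩, hs0⟩ := ((hev.filter_mono nhdsWithin_le_nhds).and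
    (self_mem_nhdsWithin (a := (0 : ℝ)) (s := Set.Ioi 0))).exists
  refine ⟨s, hs0, ?_⟩
  have hsy : 0 < s * y := mul_pos hs0 hypos
  have := (convex_polygon N).combo_interior_self_mem_interior h0
    (sidePoint_mem_polygon (N := N) (k := k) (Set.Ioo_subset_Icc_self hs1)) hsy
    (sub_nonneg.2 hs2.le) (by ring)
  convert this using 1
  rw [hu']
  have h1 : (1 - s * y) ≠ 0 := by linarith
  have h2 : sidePoint N k (t + s * x / (1 - s * y)) = z + (s * x / (1 - s * y)) • τ := by
    rw [hz, sidePoint, sidePoint]; module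
  rw [h2, smul_add, smul_smul, mul_div_cancel₀ _ h1]
  module

end FillingPairs

/-! ### Local images at boundary points, and determinants -/

namespace FillingPairs

open Set Filter Topology in
/-- A map with continuous invertible derivative on a convex set covers, near the image of a
boundary point, the images of all directions that enter the interior. -/
lemma eventually_add_smul_mem_image {E F : Type*} [NormedAddCommGroup E] [NormedSpace ℝ E]
    [CompleteSpace E] [Nontrivial E] [NormedAddCommGroup F] [NormedSpace ℝ F] {C : Set E}
    (hC : Convex ℝ C) {z : E} (hz : z ∈ C) {f : E → F} {f' : E → E →L[ℝ] F}
    (hf : ∀ᶠ x in 𝓝[C] z, HasFDerivWithinAt f (f' x) C x) (hf' : ContinuousWithinAt f' C z)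
    (A : E ≃L[ℝ] F) (hA : f' z = A) {u : E} (hu : z + u ∈ interior C) {U : Set E} (hU : U ∈ 𝓝 z) :
    ∀ᶠ t : ℝ in 𝓝[>] 0, f z + t • A u ∈ f '' (interior C ∩ U) := by
  obtain ⟨ρ, hρ, hball⟩ := Metric.nhds_basis_closedBall.mem_iff.1 (isOpen_interior.mem_nhds hu)
  set K : NNReal := ‖(A.symm : F →L[ℝ] E)‖₊ with hK
  have hKpos : 0 < K := A.nnnorm_symm_pos
  have hKpos' : (0 : ℝ) < K := hKpos
  -- Chosen so that `c * ‖u‖ = (K⁻¹ - c) * ρ`: the error of the linear approximation at `z + t • u`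
  -- is at most the radius of the ball that the image is known to cover.
  set c : NNReal := K⁻¹ * ρ.toNNReal / (‖u‖₊ + ρ.toNNReal) with hc
  have hcr : (c : ℝ) = (K : ℝ)⁻¹ * ρ / (‖u‖ + ρ) := by
    simp [hc, hρ.le]
  have hcpos : (0 : ℝ) < c := by rw [hcr]; positivity
  have hbound : ∀ᶠ x in 𝓝[C] z, ‖f' x - A‖ ≤ c := by
    have := (hf'.sub_const (A : E →L[ℝ] F)).norm
    have h2 : ‖f' z - A‖ < c := by simpa [hA] using hcpos
    exact (this.eventually (gt_mem_nhds h2)).mono fun x hx => le_of_lt hx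
  obtain ⟨r, hr, hrs⟩ := Metric.mem_nhdsWithin_iff.1
    (inter_mem (hf.and hbound) (mem_nhdsWithin_of_mem_nhds hU))
  have hs : Convex ℝ (Metric.ball z r ∩ C) := (convex_ball z r).inter hC
  have happrox : ApproximatesLinearOn f (A : E →L[ℝ] F) (Metric.ball z r ∩ C) c := by
    intro x hx y hy
    exact hs.norm_image_sub_le_of_norm_hasFDerivWithin_le'
      (fun x hx => ((hrs hx).1.1).mono inter_subset_right) (fun x hx => (hrs hx).1.2) hy hx
  have hev : ∀ᶠ t : ℝ in 𝓝[>] 0, 0 < t ∧ t ≤ 1 ∧ t * (‖u‖ + ρ) < r := by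
    have h1 : ∀ᶠ t : ℝ in 𝓝 0, t < 1 ∧ t * (‖u‖ + ρ) < r := by
      refine (gt_mem_nhds one_pos).and ?_
      have : Continuous fun t : ℝ => t * (‖u‖ + ρ) := by fun_prop
      have := this.tendsto 0
      rw [zero_mul] at this
      exact this.eventually (gt_mem_nhds hr)
    filter_upwards [h1.filter_mono nhdsWithin_le_nhds, self_mem_nhdsWithin] with t ht ht0
    exact ⟨ht0, ht.1.le, ht.2⟩
  filter_upwards [hev] with t ⟨ht0, ht1, htr⟩
  -- This ball is the image of the ball of radius `ρ` about `z + u` under the homothety with centre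
  -- `z` and ratio `t ≤ 1`, which keeps the interior of a convex set inside itself.
  have hsub1 : Metric.closedBall (z + t • u) (t * ρ) ⊆ interior C := by
    intro x hx
    have hx' : z + u + t⁻¹ • (x - (z + t • u)) ∈ interior C := by
      apply hball
      rw [mem_closedBall_iff_norm, add_sub_cancel_left, norm_smul, norm_inv, Real.norm_of_nonneg
        ht0.le, inv_mul_le_iff₀ ht0]
      exact mem_closedBall_iff_norm.1 hx
    have := hC.combo_self_interior_mem_interior hz hx' (sub_nonneg.2 ht1) ht0 (by ring)
    convert this using 1
    rw [smul_add, smul_smul, mul_inv_cancel₀ ht0.ne']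
    module
  have hsub2 : Metric.closedBall (z + t • u) (t * ρ) ⊆ Metric.ball z r := by
    intro x hx
    rw [mem_closedBall_iff_norm] at hx
    rw [mem_ball_iff_norm]
    calc ‖x - z‖ = ‖(x - (z + t • u)) + t • u‖ := by congr 1; abel
      _ ≤ t * ρ + t * ‖u‖ := by
        refine (norm_add_le _ _).trans (add_le_add hx ?_)
        rw [norm_smul, Real.norm_of_nonneg ht0.le]
      _ < r := by linarith
  have hsurj := happrox.surjOn_closedBall_of_nonlinearRightInverse A.toNonlinearRightInverse
    (b := z + t • u) (ε := t * ρ) (by positivity)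
    (fun x hx => ⟨hsub2 hx, interior_subset (hsub1 hx)⟩)
  have hzt : z + t • u ∈ Metric.ball z r ∩ C := by
    have : z + t • u ∈ Metric.closedBall (z + t • u) (t * ρ) :=
      Metric.mem_closedBall_self (by positivity)
    exact ⟨hsub2 this, interior_subset (hsub1 this)⟩
  have hmem : f z + t • A u ∈ Metric.closedBall (f (z + t • u))
      (((A.toNonlinearRightInverse.nnnorm : ℝ)⁻¹ - c) * (t * ρ)) := by
    rw [mem_closedBall_iff_norm']
    have h1 := happrox _ hzt z ⟨Metric.mem_ball_self hr, hz⟩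
    have h2 : ‖f (z + t • u) - (f z + t • A u)‖ ≤ c * (t * ‖u‖) := by
      convert h1 using 2
      · simp [sub_sub]
      · simp [norm_smul, abs_of_pos ht0]
    refine h2.trans (le_of_eq ?_)
    have h3 : (A.toNonlinearRightInverse.nnnorm : ℝ) = K := rfl
    rw [h3, hcr]
    have : ‖u‖ + ρ ≠ 0 := by positivity
    field_simp
    ring
  obtain ⟨x, hx, hxe⟩ := hsurj hmem
  refine ⟨x, ⟨hsub1 hx, ?_⟩, hxe⟩
  exact (hrs ⟨hsub2 hx, interior_subset (hsub1 hx)⟩).2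

lemma det2_smul_left (a : ℝ) (v w : Plane) : det2 (a • v) w = a * det2 v w := by
  simp [det2]; ring

lemma det2_smul_right (a : ℝ) (v w : Plane) : det2 v (a • w) = a * det2 v w := by
  simp [det2]; ring

lemma det2_swap (v w : Plane) : det2 v w = -det2 w v := by
  simp [det2]; ring

/-- The determinant of a linear map from the complex plane to `Plane`. -/
noncomputable def jac (A : ℂ →L[ℝ] Plane) : ℝ := det2 (A 1) (A Complex.I)

lemma det2_map (A : ℂ →L[ℝ] Plane) (u w : ℂ) : det2 (A u) (A w) = jac A * cross u w := by
  have h : ∀ u : ℂ, A u = u.re • A 1 + u.im • A Complex.I := by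
    intro u
    rw [← map_smul, ← map_smul, ← map_add]
    congr 1
    apply Complex.ext <;> simp
  rw [h u, h w]
  simp [det2, cross, jac]
  ring

lemma jac_ne_zero {A : ℂ →L[ℝ] Plane} (hA : Function.Injective A) : jac A ≠ 0 := by
  intro h
  have h0 : ∀ w, det2 (A 1) (A w) = 0 := fun w => by rw [det2_map, h, zero_mul]
  have hsurj : Function.Surjective (A : ℂ →ₗ[ℝ] Plane) :=
    (LinearMap.injective_iff_surjective_of_finrank_eq_finrank (by simp)).1 hA
  -- The target is `A 1` turned by a right angle, so its determinant with `A 1` is the squared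
  -- length of `A 1`.
  obtain ⟨w, hw⟩ := hsurj (!₂[-(A 1) 1, (A 1) 0] : Plane)
  have hw' : A w = (!₂[-(A 1) 1, (A 1) 0] : Plane) := hw
  have := h0 w
  rw [hw'] at this
  simp [det2] at this
  have h1 : A 1 = 0 := by
    ext i
    fin_cases i
    · simp; nlinarith [sq_nonneg ((A 1) 0), sq_nonneg ((A 1) 1)]
    · simp; nlinarith [sq_nonneg ((A 1) 0), sq_nonneg ((A 1) 1)]
  exact one_ne_zero (hA (h1.trans (map_zero A).symm))

lemma det2_map_plane (B : Plane →L[ℝ] Plane) (v w : Plane) :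
    det2 (B v) (B w) = B.det * det2 v w := by
  have h : ∀ u : Plane, B u = u 0 • B (EuclideanSpace.single 0 1)
      + u 1 • B (EuclideanSpace.single 1 1) := by
    intro u
    rw [← map_smul, ← map_smul, ← map_add]
    congr 1
    ext i
    fin_cases i <;> simp
  have hdet : B.det = det2 (B (EuclideanSpace.single 0 1)) (B (EuclideanSpace.single 1 1)) := by
    rw [ContinuousLinearMap.det,
      ← LinearMap.det_toMatrix (EuclideanSpace.basisFun (Fin 2) ℝ).toBasis, Matrix.det_fin_two]
    simp [LinearMap.toMatrix_apply, det2]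
    ring
  rw [hdet, h v, h w]
  simp [det2]
  ring

lemma jac_comp (B : Plane →L[ℝ] Plane) (A : ℂ →L[ℝ] Plane) : jac (B.comp A) = B.det * jac A :=
  det2_map_plane B _ _

lemma continuous_jac : Continuous jac := by
  unfold jac det2
  fun_prop

end FillingPairs

/-! ### Derivatives in charts, and orientation -/

namespace FillingPairs

open Set Filter Topology

section Charts

universe u
variable {S : Type u} [TopologicalSpace S] [ChartedSpace Plane S]

lemma hasFDerivWithinAt_chart {E : Type*} [NormedAddCommGroup E] [NormedSpace ℝ E] {f : E → S}
    {s : Set E} {x : E} {f' : E →L[ℝ] Plane}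
    (h : HasMFDerivWithinAt 𝓘(ℝ, E) (𝓡 2) f s x f') :
    HasFDerivWithinAt (chartAt Plane (f x) ∘ f) f' s x := by
  have : HasFDerivWithinAt (chartAt Plane (f x) ∘ f) f' (s ∩ range (id : E → E)) x := h.2
  simpa using this

/-- The manifold derivative is read in the preferred chart at the image point, which jumps as the
point moves. Passing to a fixed chart composes it with the derivative of a transition map, of
positive determinant for an oriented atlas. -/
lemma hasFDerivWithinAt_chart_of_mem [IsManifold (𝓡 2) 1 S] {E : Type*} [NormedAddCommGroup E]
    [NormedSpace ℝ E] {f : E → S} {s : Set E} {x : E} {f' : E →L[ℝ] Plane}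
    (h : HasMFDerivWithinAt 𝓘(ℝ, E) (𝓡 2) f s x f') {p : S} (hp : f x ∈ (chartAt Plane p).source) :
    HasFDerivWithinAt (chartAt Plane p ∘ f)
      ((fderiv ℝ ((chartAt Plane (f x)).symm.trans (chartAt Plane p))
        (chartAt Plane (f x) (f x))).comp f') s x := by
  set e := chartAt Plane (f x) with he
  have hx : f x ∈ e.source := mem_chart_source Plane (f x)
  have hcd : ContDiffOn ℝ 1 (e.symm.trans (chartAt Plane p)) (e.symm.trans (chartAt Plane p)).source
    := by
    have := contDiffOn_ext_coord_change (I := 𝓡 2) (n := 1) p (f x)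
    simpa [mfld_simps, ← he] using this
  have hmem : e (f x) ∈ (e.symm.trans (chartAt Plane p)).source := by
    simp [e.left_inv hx, e.map_source hx, hp]
  have hd : HasFDerivAt (e.symm.trans (chartAt Plane p)) _ (e (f x)) :=
    ((hcd.contDiffAt ((e.symm.trans (chartAt Plane p)).open_source.mem_nhds hmem)).differentiableAt
      one_ne_zero).hasFDerivAt
  have h2 := hd.comp_hasFDerivWithinAt x (hasFDerivWithinAt_chart h)
  refine h2.congr_of_eventuallyEq ?_ ?_
  · have : ∀ᶠ y in 𝓝[s] x, f y ∈ e.source := h.1 (e.open_source.mem_nhds hx)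
    filter_upwards [this] with y hy
    simp [← he, e.left_inv hy]
  · simp [← he, e.left_inv hx]

/-- The derivative of a plane map to a surface within a set, in the preferred chart at the image
point. -/
noncomputable def tangentWithin (f : ℂ → S) (C : Set ℂ) (z : ℂ) : ℂ →L[ℝ] Plane :=
  mfderivWithin 𝓘(ℝ, ℂ) (𝓡 2) f C z

lemma hasMFDerivWithinAt_tangentWithin {f : ℂ → S} {C : Set ℂ}
    (hf : ContMDiffOn 𝓘(ℝ, ℂ) (𝓡 2) 1 f C) {z : ℂ} (hz : z ∈ C) :
    HasMFDerivWithinAt 𝓘(ℝ, ℂ) (𝓡 2) f C z (tangentWithin f C z) :=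
  ((hf z hz).mdifferentiableWithinAt one_ne_zero).hasMFDerivWithinAt

/-- The derivative of a `C¹` map on a convex set, read in a fixed chart. -/
lemma chart_fderivWithin [IsManifold (𝓡 2) 1 S] [HasOrientedAtlas S] {f : ℂ → S} {C : Set ℂ}
    (hC : Convex ℝ C) (hC' : (interior C).Nonempty) (hf : ContMDiffOn 𝓘(ℝ, ℂ) (𝓡 2) 1 f C)
    {z₀ : ℂ} (hz₀ : z₀ ∈ C) :
    (∀ᶠ z in 𝓝[C] z₀, HasFDerivWithinAt (chartAt Plane (f z₀) ∘ f)
      (fderivWithin ℝ (chartAt Plane (f z₀) ∘ f) C z) C z) ∧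
    ContinuousWithinAt (fderivWithin ℝ (chartAt Plane (f z₀) ∘ f) C) C z₀ ∧
    fderivWithin ℝ (chartAt Plane (f z₀) ∘ f) C z₀ = tangentWithin f C z₀ ∧
    ∀ᶠ z in 𝓝[C] z₀, ∃ B : Plane →L[ℝ] Plane, 0 < B.det ∧
      fderivWithin ℝ (chartAt Plane (f z₀) ∘ f) C z = B.comp (tangentWithin f C z) := by
  have huniq : UniqueDiffOn ℝ C := uniqueDiffOn_convex hC hC'
  have hsrc : ∀ᶠ z in 𝓝[C] z₀, f z ∈ (chartAt Plane (f z₀)).source :=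
    (hf z₀ hz₀).continuousWithinAt ((chartAt Plane (f z₀)).open_source.mem_nhds
      (mem_chart_source Plane (f z₀)))
  have hd : ∀ z ∈ C, f z ∈ (chartAt Plane (f z₀)).source → _ := fun z hz hzs =>
    hasFDerivWithinAt_chart_of_mem (hasMFDerivWithinAt_tangentWithin hf hz) hzs
  refine ⟨?_, ?_, ?_, ?_⟩
  · filter_upwards [hsrc, self_mem_nhdsWithin] with z hzs hz
    exact (hd z hz hzs).differentiableWithinAt.hasFDerivWithinAt
  · have h1 : ContDiffWithinAt ℝ 1 (chartAt Plane (f z₀) ∘ f) (C ∩ range (id : ℂ → ℂ)) z₀ :=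
      (contMDiffWithinAt_iff.1 (hf z₀ hz₀)).2
    rw [range_id, inter_univ] at h1
    exact (h1.fderivWithin_right (m := 0) huniq (by simp) hz₀).continuousWithinAt
  · exact (hasFDerivWithinAt_chart (hasMFDerivWithinAt_tangentWithin hf hz₀)).fderivWithin
      (huniq z₀ hz₀)
  · filter_upwards [hsrc, self_mem_nhdsWithin] with z hzs hz
    refine ⟨_, ?_, (hd z hz hzs).fderivWithin (huniq z hz)⟩
    refine HasOrientedAtlas.det_pos _ (chart_mem_atlas Plane (f z)) _
      (chart_mem_atlas Plane (f z₀)) _ ?_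
    have hx := mem_chart_source Plane (f z)
    simp [(chartAt Plane (f z)).left_inv hx, (chartAt Plane (f z)).map_source hx, hzs]

/-- A regular map of a convex plane set to an oriented surface preserves the orientation everywhere
or nowhere. -/
lemma sign_jac_tangentWithin_eq [IsManifold (𝓡 2) 1 S] [HasOrientedAtlas S] {f : ℂ → S}
    {C : Set ℂ} (hC : Convex ℝ C) (hC' : (interior C).Nonempty)
    (hf : ContMDiffOn 𝓘(ℝ, ℂ) (𝓡 2) 1 f C)
    (hreg : ∀ z ∈ C, Function.Injective (tangentWithin f C z)) {z w : ℂ} (hz : z ∈ C)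
    (hw : w ∈ C) :
    SignType.sign (jac (tangentWithin f C z)) = SignType.sign (jac (tangentWithin f C w)) := by
  -- It suffices that the sign is locally constant. Near `z₀`, reading in the chart at `f z₀`
  -- changes the Jacobian by a positive factor and makes it continuous and nonzero at `z₀`.
  refine hC.isPreconnected.constant (f := fun z => SignType.sign (jac (tangentWithin f C z)))
    (fun z₀ hz₀ => ?_) hz hw
  obtain ⟨-, h2, h3, h4⟩ := chart_fderivWithin hC hC' hf hz₀
  have hne := jac_ne_zero (hreg z₀ hz₀)
  rw [← h3] at hne
  have hj : ContinuousWithinAt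
      (fun z => jac (fderivWithin ℝ (chartAt Plane (f z₀) ∘ f) C z)) C z₀ :=
    ContinuousAt.comp_continuousWithinAt (g := jac) continuous_jac.continuousAt h2
  have hcont : ContinuousWithinAt
      (fun z => SignType.sign (jac (fderivWithin ℝ (chartAt Plane (f z₀) ∘ f) C z))) C z₀ :=
    ContinuousAt.comp_continuousWithinAt (g := SignType.sign) (continuousAt_sign_of_ne_zero hne) hj
  refine hcont.congr_of_eventuallyEq ?_ (by rw [h3])
  filter_upwards [h4] with z ⟨B, hB, hz⟩
  rw [hz, jac_comp, sign_mul, sign_pos hB, one_mul]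

end Charts

end FillingPairs

/-! ### Glued sides run in opposite directions -/

namespace FillingPairs

open Set Filter Topology

section Sides

universe u
variable {S : Type u} [TopologicalSpace S] [ChartedSpace Plane S] [IsManifold (𝓡 2) 1 S]
  [HasOrientedAtlas S]

lemma exists_continuousLinearEquiv {A : ℂ →L[ℝ] Plane} (hA : Function.Injective A) :
    ∃ A' : ℂ ≃L[ℝ] Plane, (A' : ℂ →L[ℝ] Plane) = A := by
  have hsurj : Function.Surjective (A : ℂ →ₗ[ℝ] Plane) :=
    (LinearMap.injective_iff_surjective_of_finrank_eq_finrank (by simp)).1 hA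
  exact ⟨ContinuousLinearEquiv.ofBijective A (LinearMap.ker_eq_bot.2 hA)
    (LinearMap.range_eq_top.2 hsurj), ContinuousLinearEquiv.coe_ofBijective _ _ _⟩

lemma add_smul_mem_interior_of_le {E : Type*} [NormedAddCommGroup E] [NormedSpace ℝ E]
    {C : Set E} (hC : Convex ℝ C) {z u : E} (hz : z ∈ C) {s r : ℝ} (hr : 0 < r) (hrs : r ≤ s)
    (hs : z + s • u ∈ interior C) : z + r • u ∈ interior C := by
  have hs0 : 0 < s := hr.trans_le hrs
  have := hC.combo_self_interior_mem_interior hz hs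
    (sub_nonneg.2 ((div_le_one hs0).2 hrs)) (div_pos hr hs0) (by ring)
  convert this using 1
  rw [smul_add, smul_smul, div_mul_cancel₀ _ hs0.ne']
  module

/-- A regular map that is injective on the interior of a convex set cannot send inward directions
at two different points to the same tangent vector. -/
lemma tangentWithin_ne_of_injOn_interior {f : ℂ → S} {C : Set ℂ} (hC : Convex ℝ C)
    (hf : ContMDiffOn 𝓘(ℝ, ℂ) (𝓡 2) 1 f C)
    (hreg : ∀ z ∈ C, Function.Injective (tangentWithin f C z)) (hinj : InjOn f (interior C))
    {z w : ℂ} (hz : z ∈ C) (hw : w ∈ C) (hzw : z ≠ w) (hfzw : f z = f w) {u u' : ℂ} {s s' : ℝ}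
    (hs : 0 < s) (hs' : 0 < s') (hu : z + s • u ∈ interior C) (hu' : w + s' • u' ∈ interior C) :
    tangentWithin f C z u ≠ tangentWithin f C w u' := by
  intro heq
  set r := min s s' with hr
  have hr0 : 0 < r := lt_min hs hs'
  replace hu := add_smul_mem_interior_of_le hC hz hr0 (min_le_left s s') hu
  replace hu' := add_smul_mem_interior_of_le hC hw hr0 (min_le_right s s') hu'
  obtain ⟨U, W, hU, hW, hzU, hwW, hUW⟩ := t2_separation hzw
  have key : ∀ x ∈ C, ∀ v, x + r • v ∈ interior C → ∀ V ∈ 𝓝 x, ∀ᶠ t : ℝ in 𝓝[>] 0,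
      chartAt Plane (f x) (f x) + t • tangentWithin f C x (r • v) ∈
        (chartAt Plane (f x) ∘ f) '' (interior C ∩ (V ∩ f ⁻¹' (chartAt Plane (f x)).source)) := by
    intro x hx v hv V hV
    obtain ⟨h1, h2, h3, -⟩ := chart_fderivWithin hC ⟨_, hv⟩ hf hx
    obtain ⟨A, hA⟩ := exists_continuousLinearEquiv (hreg x hx)
    have hsrc : ∀ᶠ y in 𝓝[C] x, f y ∈ (chartAt Plane (f x)).source :=
      (hf x hx).continuousWithinAt ((chartAt Plane (f x)).open_source.mem_nhds
        (mem_chart_source Plane (f x)))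
    obtain ⟨T, hT, hTs⟩ := mem_nhdsWithin_iff_exists_mem_nhds_inter.1 hsrc
    have := eventually_add_smul_mem_image hC hx h1 h2 A (h3.trans hA.symm) hv (inter_mem hV hT)
    filter_upwards [this] with t ht
    obtain ⟨y, ⟨hy1, hy2⟩, hy3⟩ := ht
    refine ⟨y, ⟨hy1, hy2.1, hTs ⟨hy2.2, interior_subset hy1⟩⟩, ?_⟩
    rw [hy3, ← hA]
    rfl
  -- For small `t` the same point on the common tangent ray is hit from interior points near `z` and
  -- near `w`, in disjoint neighbourhoods.
  obtain ⟨t, ⟨x, hx, hxt⟩, ⟨y, hy, hyt⟩⟩ := ((key z hz u hu U (hU.mem_nhds hzU)).and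
    (key w hw u' hu' W (hW.mem_nhds hwW))).exists
  rw [map_smul, heq, hfzw] at hxt
  rw [map_smul] at hyt
  have hxy : f x = f y := by
    refine (chartAt Plane (f w)).injOn ?_ hy.2.2 (hxt.trans hyt.symm)
    have := hx.2.2
    rwa [hfzw] at this
  have := hinj hx.1 hy.1 hxy
  exact hUW.le_bot ⟨hx.2.1, this ▸ hy.2.1⟩

/-- Two different sides that are glued to the same arc run through it in opposite directions. -/
lemma mul_nonpos_of_edge_parallel {N : ℕ} (hN : 3 ≤ N) (h0 : (0 : ℂ) ∈ interior (polygon N))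
    {f : ℂ → S} (hf : ContMDiffOn 𝓘(ℝ, ℂ) (𝓡 2) 1 f (polygon N))
    (hreg : ∀ z ∈ polygon N, Function.Injective (tangentWithin f (polygon N) z))
    (hinj : InjOn f (interior (polygon N))) {k l : ℕ} (hkl : k % N ≠ l % N) {s t : ℝ}
    (hs : s ∈ Ioo (0 : ℝ) 1) (ht : t ∈ Ioo (0 : ℝ) 1)
    (hst : f (sidePoint N k s) = f (sidePoint N l t)) {v : Plane} {c d : ℝ}
    (hc : tangentWithin f (polygon N) (sidePoint N k s) (edge N k) = c • v)
    (hd : tangentWithin f (polygon N) (sidePoint N l t) (edge N l) = d • v) : c * d ≤ 0 := by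
  by_contra! hcd
  have hz : sidePoint N k s ∈ polygon N := sidePoint_mem_polygon (Ioo_subset_Icc_self hs)
  have hw : sidePoint N l t ∈ polygon N := sidePoint_mem_polygon (Ioo_subset_Icc_self ht)
  have hzw : sidePoint N k s ≠ sidePoint N l t := by
    intro h
    have hdisj := Set.disjoint_left.1 (disjoint_openSide hN hkl)
    refine hdisj (a := sidePoint N k s) ?_ ?_
    · rw [openSide_eq_image]; exact mem_image_of_mem _ hs
    · rw [h, openSide_eq_image]; exact mem_image_of_mem _ ht
  have hsign := sign_jac_tangentWithin_eq (convex_polygon N) ⟨0, h0⟩ hf hreg hz hw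
  have hne := jac_ne_zero (hreg _ hz)
  have hne' := jac_ne_zero (hreg _ hw)
  set A := tangentWithin f (polygon N) (sidePoint N k s) with hA
  set B := tangentWithin f (polygon N) (sidePoint N l t) with hB
  obtain ⟨B', hB'⟩ := exists_continuousLinearEquiv (hreg _ hw)
  -- The right normal of side `k`, which points inwards. Below, `u'` is the direction at the other
  -- point with the same image; it is shown to point inwards too if `c * d > 0`.
  set u : ℂ := -Complex.I * edge N k with hu
  have hcu : cross (edge N k) u < 0 := by
    have h1 : edge N k ≠ 0 := edge_ne_zero hN k
    have h2 := Complex.normSq_pos.2 h1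
    rw [Complex.normSq_apply] at h2
    simp only [hu, cross, Complex.mul_re, Complex.mul_im, Complex.neg_re, Complex.neg_im,
      Complex.I_re, Complex.I_im]
    linarith
  set u' : ℂ := B'.symm (A u) with hu'
  have hBu' : B u' = A u := by
    rw [hB, ← hB', hu']
    exact B'.apply_symm_apply _
  have hcu' : cross (edge N l) u' < 0 := by
    have e1 := det2_map A (edge N k) u
    have e2 := det2_map B (edge N l) u'
    rw [hc, det2_smul_left] at e1
    rw [hd, det2_smul_left, hBu'] at e2
    have hJ : 0 < jac A * jac B := by
      rcases lt_or_gt_of_ne hne with h | h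
      · rw [sign_neg h, eq_comm, sign_eq_neg_one_iff] at hsign
        exact mul_pos_of_neg_of_neg h hsign
      · rw [sign_pos h, eq_comm, sign_eq_one_iff] at hsign
        exact mul_pos h hsign
    have e3 : (c * d) * (det2 v (A u) * det2 v (A u))
        = (jac A * jac B) * (cross (edge N k) u * cross (edge N l) u') := by
      linear_combination (d * det2 v (A u)) * e1 + jac A * cross (edge N k) u * e2
    have hv : det2 v (A u) ≠ 0 := by
      intro h
      rw [h, mul_zero] at e1
      exact mul_ne_zero hne hcu.ne e1.symm
    have e4 : 0 < cross (edge N k) u * cross (edge N l) u' := by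
      have := mul_pos hcd (mul_self_pos.2 hv)
      rw [e3] at this
      exact (mul_pos_iff_of_pos_left hJ).1 this
    exact neg_of_mul_pos_right e4 hcu.le
  obtain ⟨r, hr, hrz⟩ := exists_add_smul_mem_interior hN h0 hs hcu
  obtain ⟨r', hr', hrw⟩ := exists_add_smul_mem_interior hN h0 ht hcu'
  exact tangentWithin_ne_of_injOn_interior (convex_polygon N) hf hreg hinj hz hw hzw hst hr hr'
    hrz hrw hBu'.symm

end Sides

end FillingPairs

/-! ### Parameters on simple closed curves -/

namespace FillingPairs

open Set Filter Topology

universe u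
variable {S : Type u} [TopologicalSpace S] [ChartedSpace Plane S]

namespace SimpleClosedCurve

variable (γ δ : SimpleClosedCurve S)

lemma continuous : Continuous γ.toFun := γ.contMDiff.continuous

lemma apply_add_int (t : ℝ) (n : ℤ) : γ (t + n) = γ t := by
  simpa using γ.periodic.int_mul n t

lemma apply_mem_image (t : ℝ) : γ t ∈ γ.image := mem_range_self t

/-- The derivative of the curve as a linear map to the plane. -/
noncomputable def tangentMap (t : ℝ) : ℝ →L[ℝ] Plane :=
  (1 : ℝ →L[ℝ] ℝ).smulRight (γ.velocity t)

lemma tangentMap_apply (t x : ℝ) : γ.tangentMap t x = x • γ.velocity t := by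
  simp [tangentMap]

lemma hasMFDerivAt (t : ℝ) : HasMFDerivAt 𝓘(ℝ, ℝ) (𝓡 2) γ.toFun t (γ.tangentMap t) := by
  have h := ((γ.contMDiff t).mdifferentiableAt (by simp)).hasMFDerivAt
  let B : ℝ →L[ℝ] Plane := mfderiv 𝓘(ℝ, ℝ) (𝓡 2) γ.toFun t
  have e : γ.tangentMap t = B := by
    refine ContinuousLinearMap.ext_ring ?_
    rw [tangentMap_apply, one_smul]
    rfl
  rw [e]
  exact h

lemma velocity_ne_zero (t : ℝ) : γ.velocity t ≠ 0 := by
  intro h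
  have h1 : mfderiv 𝓘(ℝ, ℝ) (𝓡 2) γ.toFun t (1 : ℝ) = mfderiv 𝓘(ℝ, ℝ) (𝓡 2) γ.toFun t (0 : ℝ) :=
    Eq.trans h (map_zero (mfderiv 𝓘(ℝ, ℝ) (𝓡 2) γ.toFun t)).symm
  exact one_ne_zero (α := ℝ) (γ.regular t h1)

/-- Both derivatives are read in the preferred chart of the same point, so periodicity of the curve
passes to them. -/
lemma velocity_add_int (t : ℝ) (n : ℤ) : γ.velocity (t + n) = γ.velocity t := by
  have h1 : HasMFDerivAt 𝓘(ℝ, ℝ) 𝓘(ℝ, ℝ) (fun s : ℝ => s + n) t (1 : ℝ →L[ℝ] ℝ) :=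
    ((hasFDerivAt_id t).add_const (n : ℝ)).hasMFDerivAt
  have h2 := (γ.hasMFDerivAt (t + n)).comp t h1
  have h3 := h2.congr_of_eventuallyEq (f₁ := γ.toFun)
    (Eventually.of_forall fun s => (γ.apply_add_int s n).symm)
  have h4 := hasMFDerivAt_unique h3 (γ.hasMFDerivAt t)
  have h5 := congrArg (fun A : ℝ →L[ℝ] Plane => A 1) h4
  have h6 : γ.tangentMap (t + n) 1 = γ.tangentMap t 1 := h5
  simpa [tangentMap_apply] using h6

lemma velocity_eq_of_apply_eq {s t : ℝ} (h : γ s = γ t) : γ.velocity s = γ.velocity t := by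
  obtain ⟨n, hn⟩ := γ.injective_mod s t h
  have : s = t + n := by linarith
  rw [this, velocity_add_int]

/-- Every path on a simple closed curve lifts to its parameter line. -/
lemma exists_lift [T2Space S] {f : ℝ → S} (hf : ContinuousOn f (Icc 0 1))
    (hmem : ∀ t ∈ Icc (0 : ℝ) 1, f t ∈ γ.image) :
    ∃ φ : ℝ → ℝ, Continuous φ ∧ ∀ t ∈ Icc (0 : ℝ) 1, f t = γ (φ t) := by
  let g : AddCircle (1 : ℝ) → S := γ.periodic.lift
  -- By compactness of the circle, the curve embeds `ℝ / ℤ` in the Hausdorff space `S`; the path is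
  -- pulled back to the circle and lifted through the covering by `ℝ`.
  have hg : Continuous g := by
    have : Topology.IsQuotientMap ((↑) : ℝ → AddCircle (1 : ℝ)) :=
      QuotientAddGroup.isQuotientMap_mk _
    exact this.continuous_iff.2 γ.continuous
  have hginj : Function.Injective g := by
    intro x y
    induction x using QuotientAddGroup.induction_on with | H x => ?_
    induction y using QuotientAddGroup.induction_on with | H y => ?_
    intro h
    obtain ⟨n, hn⟩ := γ.injective_mod x y h
    have h0 : ((x - y : ℝ) : AddCircle (1 : ℝ)) = 0 := AddCircle.coe_eq_zero_iff _ |>.2 ⟨n, by simp [hn]⟩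
    exact sub_eq_zero.1 h0
  have : Fact ((0 : ℝ) < 1) := ⟨one_pos⟩
  have hemb : Topology.IsClosedEmbedding g := hg.isClosedEmbedding hginj
  have hrange : range g = γ.image := by
    ext x
    constructor
    · rintro ⟨y, rfl⟩
      induction y using QuotientAddGroup.induction_on with | H y => ?_
      exact ⟨y, rfl⟩
    · rintro ⟨y, rfl⟩
      exact ⟨(y : AddCircle (1 : ℝ)), rfl⟩
  let e := hemb.isEmbedding.toHomeomorph
  let F : C(unitInterval, AddCircle (1 : ℝ)) :=
    ⟨fun t => e.symm ⟨f t, hrange ▸ hmem t t.2⟩, by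
      refine e.symm.continuous.comp (Continuous.subtype_mk ?_ _)
      exact continuousOn_iff_continuous_domRestrict.1 hf⟩
  have hF : ∀ t, g (F t) = f t := fun t => by
    have := congrArg Subtype.val (e.apply_symm_apply ⟨f t, hrange ▸ hmem t t.2⟩)
    exact this
  obtain ⟨x₀, hx₀⟩ := QuotientAddGroup.mk_surjective (F 0)
  obtain ⟨Γ, hΓ, -⟩ := (AddCircle.isCoveringMap_coe (1 : ℝ)).exists_path_lifts F x₀ hx₀.symm
  refine ⟨fun t => Γ (projIcc 0 1 zero_le_one t), Γ.continuous.comp continuous_projIcc,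
    fun t ht => ?_⟩
  have h1 : ((Γ ⟨t, ht⟩ : ℝ) : AddCircle (1 : ℝ)) = F ⟨t, ht⟩ := congrFun hΓ ⟨t, ht⟩
  have h2 := hF ⟨t, ht⟩
  rw [← h1] at h2
  dsimp only
  rw [projIcc_of_mem zero_le_one ht]
  exact h2.symm

/-- The parameter of a differentiable path on a simple closed curve is differentiable. -/
lemma differentiableWithinAt_of_comp [IsManifold (𝓡 2) 1 S] {φ : ℝ → ℝ} {s : Set ℝ} {t : ℝ}
    (hφ : ContinuousWithinAt φ s t) {A : ℝ →L[ℝ] Plane}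
    (h : HasMFDerivWithinAt 𝓘(ℝ, ℝ) (𝓡 2) (γ.toFun ∘ φ) s t A) :
    DifferentiableWithinAt ℝ φ s t := by
  set e := chartAt Plane (γ (φ t)) with he
  have hcd : ContDiffAt ℝ 1 (e ∘ γ.toFun) (φ t) := by
    have h1 := (contMDiffAt_iff.1 ((γ.contMDiff (φ t)).of_le (show (1 : WithTop ℕ∞) ≤ ∞ by simp))).2
    have h2 : ContDiffWithinAt ℝ 1 (e ∘ γ.toFun) (range (id : ℝ → ℝ)) (φ t) := h1
    rwa [range_id, contDiffWithinAt_univ] at h2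
  have hder : HasFDerivAt (e ∘ γ.toFun) (γ.tangentMap (φ t)) (φ t) := by
    have := hasFDerivWithinAt_chart (hasMFDerivWithinAt_univ.2 (γ.hasMFDerivAt (φ t)))
    exact hasFDerivWithinAt_univ.1 this
  have hstrict := hcd.hasStrictFDerivAt' hder one_ne_zero
  -- Pairing the chart with the velocity turns the curve into a scalar function with derivative
  -- `‖velocity‖² ≠ 0`; its local inverse recovers `φ` from the differentiable path.
  set L := innerSL ℝ (γ.velocity (φ t)) with hL
  have hψ : HasStrictDerivAt (fun x => L (e (γ x))) (L (γ.velocity (φ t))) (φ t) := by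
    have := (L.hasStrictFDerivAt.comp (φ t) hstrict).hasStrictDerivAt
    simpa [tangentMap_apply] using this
  have hne : L (γ.velocity (φ t)) ≠ 0 := by
    simp [hL, γ.velocity_ne_zero]
  have h1 : ∀ᶠ x in 𝓝[s] t, φ x = (hψ.localInverse _ _ _ hne) (L (e (γ (φ x)))) :=
    (hφ.eventually (hψ.eventually_left_inverse hne)).mono fun x hx => hx.symm
  have h2 : DifferentiableWithinAt ℝ (fun x => L (e (γ (φ x)))) s t :=
    L.differentiableAt.comp_differentiableWithinAt t
      (hasFDerivWithinAt_chart h).differentiableWithinAt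
  have h3 : DifferentiableWithinAt ℝ
      (fun x => (hψ.localInverse _ _ _ hne) (L (e (γ (φ x))))) s t :=
    (hψ.to_localInverse hne).hasDerivAt.differentiableAt.comp_differentiableWithinAt t h2
  exact h3.congr_of_eventuallyEq h1 (hψ.eventually_left_inverse hne).self_of_nhds.symm

variable {γ δ}

/-- The end points of the parameter interval of a subarc lie on the other curve. -/
lemma endpoints_mem_image {a b : ℝ} (hab : a < b) (hinj : InjOn γ.toFun (Ioo a b))
    (hA : IsSubarc γ δ (γ.toFun '' Ioo a b)) : γ a ∈ δ.image ∧ γ b ∈ δ.image := by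
  obtain ⟨x, hx, hxA⟩ := hA
  have hsub : γ.toFun '' Ioo a b ⊆ γ.image \ δ.image := by
    rw [hxA]; exact connectedComponentIn_subset _ _
  have hxmem : x ∈ γ.toFun '' Ioo a b := by
    rw [hxA]; exact mem_connectedComponentIn hx
  -- An end point off `δ` could be added to the interval without losing connectedness, so its image
  -- would lie in the same component.
  have key : ∀ c ∈ Icc a b, γ c ∉ δ.image → ∃ r ∈ Ioo a b, γ r = γ c := by
    intro c hc hcδ
    have h1 : IsPreconnected (insert c (Ioo a b)) := by
      refine isPreconnected_Ioo.subset_closure (subset_insert _ _) ?_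
      rw [closure_Ioo hab.ne]
      exact insert_subset hc Ioo_subset_Icc_self
    have h2 := (h1.image γ.toFun γ.continuous.continuousOn).subset_connectedComponentIn
      (image_mono (subset_insert _ _) hxmem) (F := γ.image \ δ.image) (by
        rw [image_insert_eq]
        exact insert_subset ⟨γ.apply_mem_image c, hcδ⟩ hsub)
    rw [← hxA] at h2
    exact h2 (mem_image_of_mem _ (mem_insert c _))
  constructor
  · by_contra hc
    obtain ⟨r, hr, hrc⟩ := key a (left_mem_Icc.2 hab.le) hc
    obtain ⟨n, hn⟩ := γ.injective_mod r a hrc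
    have hn1 : (0 : ℝ) < n := by rw [← hn]; linarith [hr.1]
    have hn2 : (1 : ℝ) ≤ n := by exact_mod_cast Int.cast_pos.1 hn1
    -- Now `r = a + n` lies inside the interval, which is thus longer than the period `n`; some `y`
    -- and `y + n` both lie in it.
    obtain ⟨y, hy1, hy2⟩ := exists_between (show a < a + (b - r) by linarith [hr.2])
    have := @hinj y ⟨hy1, by linarith [hr.1]⟩ (y + n) ⟨by linarith, by linarith⟩
      (γ.apply_add_int y n).symm
    linarith
  · by_contra hc
    obtain ⟨r, hr, hrc⟩ := key b (right_mem_Icc.2 hab.le) hc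
    obtain ⟨n, hn⟩ := γ.injective_mod b r hrc.symm
    have hn1 : (0 : ℝ) < n := by rw [← hn]; linarith [hr.2]
    obtain ⟨y, hy1, hy2⟩ := exists_between (show b - (r - a) < b by linarith [hr.1])
    have := @hinj (y - n) ⟨by linarith, by linarith⟩ y ⟨by linarith [hr.2], by linarith⟩
      (by have := γ.apply_add_int (y - n) n; rw [sub_add_cancel] at this; exact this.symm)
    linarith

/-- Parameter intervals of the same subarc have the same end points on the curve. -/
lemma endpoints_eq {a b a' b' r r' : ℝ} (ha : γ a ∈ δ.image) (hb : γ b ∈ δ.image)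
    (ha' : γ a' ∈ δ.image) (hb' : γ b' ∈ δ.image) (h : ∀ t ∈ Ioo a b, γ t ∉ δ.image)
    (h' : ∀ t ∈ Ioo a' b', γ t ∉ δ.image) (hr : r ∈ Ioo a b) (hr' : r' ∈ Ioo a' b')
    (hrr' : γ r = γ r') : γ a = γ a' ∧ γ b = γ b' := by
  obtain ⟨n, hn⟩ := γ.injective_mod r r' hrr'
  have hsub : ∀ t, γ (t - n) = γ t := fun t => by
    have := γ.apply_add_int (t - n) n; rw [sub_add_cancel] at this; exact this.symm
  -- After translation by `n` the intervals meet, and an end point of one inside the other would be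
  -- a point of `δ` where there is none.
  have e1 : a = a' + n := by
    apply le_antisymm
    · by_contra! hlt
      exact h' (a - n) ⟨by linarith, by linarith [hr.1, hr'.2]⟩ (by rwa [hsub])
    · by_contra! hlt
      exact h (a' + n) ⟨by linarith, by linarith [hr'.1, hr.2]⟩ (by rwa [γ.apply_add_int])
  have e2 : b = b' + n := by
    apply le_antisymm
    · by_contra! hlt
      exact h (b' + n) ⟨by linarith [hr'.2, hr.1], by linarith⟩ (by rwa [γ.apply_add_int])
    · by_contra! hlt
      exact h' (b - n) ⟨by linarith [hr'.1, hr.2], by linarith⟩ (by rwa [hsub])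
  rw [e1, e2, γ.apply_add_int, γ.apply_add_int]
  exact ⟨rfl, rfl⟩

end SimpleClosedCurve

end FillingPairs

/-! ### Lifting polygon sides to the parameter line -/

namespace FillingPairs

open Set Filter Topology

universe u
variable {S : Type u} [TopologicalSpace S] [ChartedSpace Plane S]

/-- The function `φ` lifts the `k`-th side of the polygon, glued to the surface by `f`, to the
parameter line of `γ`; the side runs along `γ` forwards if `σ = 1` and backwards if `σ = -1`, between
two points of `δ`. -/
structure IsSideLift (f : ℂ → S) (γ δ : SimpleClosedCurve S) (N k : ℕ) (σ : SignType)
    (φ : ℝ → ℝ) : Prop where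
  continuous : Continuous φ
  eq : ∀ t ∈ Icc (0 : ℝ) 1, f (sidePoint N k t) = γ (φ t)
  mono : σ = 1 ∧ StrictMonoOn φ (Icc 0 1) ∨ σ = -1 ∧ StrictAntiOn φ (Icc 0 1)
  start : γ (φ 0) ∈ δ.image
  finish : γ (φ 1) ∈ δ.image
  off : ∀ t ∈ Ioo (0 : ℝ) 1, γ (φ t) ∉ δ.image
  deriv : ∀ t ∈ Icc (0 : ℝ) 1, ∃ c : ℝ, SignType.sign c = σ ∧
    tangentWithin f (polygon N) (sidePoint N k t) (edge N k) = c • γ.velocity (φ t)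

/-- Continuity gives weak inequalities at the end points; two intermediate points keep the
comparison strict. -/
lemma strictMonoOn_Icc_of_Ioo {a b : ℝ} {φ : ℝ → ℝ} (hφ : Continuous φ)
    (h : StrictMonoOn φ (Ioo a b)) : StrictMonoOn φ (Icc a b) := by
  intro s hs t ht hst
  obtain ⟨x, hsx, hxt⟩ := exists_between hst
  obtain ⟨y, hxy, hyt⟩ := exists_between hxt
  have hx : x ∈ Ioo a b := ⟨hs.1.trans_lt hsx, hxt.trans_le ht.2⟩
  have hy : y ∈ Ioo a b := ⟨hx.1.trans hxy, hyt.trans_le ht.2⟩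
  have h1 : φ s ≤ φ x := by
    refine le_of_tendsto (hφ.continuousWithinAt (s := Ioi s) (x := s)) ?_
    filter_upwards [Ioo_mem_nhdsGT hsx] with r hr
    exact (h ⟨hs.1.trans_lt hr.1, hr.2.trans hx.2⟩ hx hr.2).le
  have h2 : φ y ≤ φ t := by
    refine ge_of_tendsto (hφ.continuousWithinAt (s := Iio t) (x := t)) ?_
    filter_upwards [Ioo_mem_nhdsLT hyt] with r hr
    exact (h hy ⟨hy.1.trans hr.1, hr.2.trans_le ht.2⟩ hr.1).le
  exact h1.trans_lt ((h hx hy hxy).trans_le h2)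

lemma strictMonoOn_Icc_or_strictAntiOn_Icc {φ : ℝ → ℝ} (hφ : Continuous φ)
    (hinj : InjOn φ (Ioo 0 1)) : StrictMonoOn φ (Icc 0 1) ∨ StrictAntiOn φ (Icc 0 1) := by
  refine (hφ.continuousOn.strictMonoOn_of_injOn_Ioo one_pos hinj).imp
    (strictMonoOn_Icc_of_Ioo hφ) fun h => ?_
  have := strictMonoOn_Icc_of_Ioo hφ.neg h.neg
  simpa using this.neg

lemma exists_isSideLift [T2Space S] [IsManifold (𝓡 2) 1 S] {N : ℕ} (hN : 3 ≤ N)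
    {f : ℂ → S} (hf : ContMDiffOn 𝓘(ℝ, ℂ) (𝓡 2) 1 f (polygon N))
    (hreg : ∀ z ∈ polygon N, Function.Injective (tangentWithin f (polygon N) z))
    {γ δ : SimpleClosedCurve S} {k : ℕ} (hinj : InjOn f (openSide N k))
    (hA : IsSubarc γ δ (f '' openSide N k)) : ∃ σ φ, IsSideLift f γ δ N k σ φ := by
  have hmaps : MapsTo (sidePoint N k) (Icc 0 1) (polygon N) := fun t ht => sidePoint_mem_polygon ht
  have hcont : ContinuousOn (f ∘ sidePoint N k) (Icc 0 1) :=
    hf.continuousOn.comp (continuous_sidePoint N k).continuousOn hmaps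
  have hsub : f '' openSide N k ⊆ γ.image \ δ.image := by
    obtain ⟨x, -, hx⟩ := hA
    rw [hx]; exact connectedComponentIn_subset _ _
  have hIoo : ∀ t ∈ Ioo (0 : ℝ) 1, f (sidePoint N k t) ∈ γ.image \ δ.image := fun t ht =>
    hsub (mem_image_of_mem f (by rw [openSide_eq_image]; exact mem_image_of_mem _ ht))
  have hclosed : IsClosed γ.image := by
    have : γ.image = γ.toFun '' Icc 0 1 := by
      refine Subset.antisymm ?_ (image_subset_range _ _)
      rintro _ ⟨t, rfl⟩
      refine ⟨Int.fract t, ⟨Int.fract_nonneg t, (Int.fract_lt_one t).le⟩, ?_⟩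
      have := γ.apply_add_int (Int.fract t) ⌊t⌋
      rw [Int.fract_add_floor] at this
      exact this.symm
    rw [this]
    exact (isCompact_Icc.image γ.continuous).isClosed
  have hmem : ∀ t ∈ Icc (0 : ℝ) 1, (f ∘ sidePoint N k) t ∈ γ.image := by
    have h1 : MapsTo (f ∘ sidePoint N k) (Ioo 0 1) γ.image := fun t ht => (hIoo t ht).1
    have hcl : closure (Ioo (0 : ℝ) 1) = Icc 0 1 := closure_Ioo zero_ne_one
    have h2 := h1.closure_of_continuousOn (by rwa [hcl])
    rw [hcl, hclosed.closure_eq] at h2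
    exact h2
  obtain ⟨φ, hφ, hlift⟩ := γ.exists_lift hcont hmem
  have hsinj : InjOn (f ∘ sidePoint N k) (Ioo 0 1) := by
    refine hinj.comp (fun s _ t _ hst => ?_) (fun t ht => ?_)
    · exact smul_left_injective ℝ (edge_ne_zero hN k) (add_left_cancel hst)
    · rw [openSide_eq_image]; exact mem_image_of_mem _ ht
  have hφinj : InjOn φ (Ioo 0 1) := by
    intro s hs t ht hst
    refine hsinj hs ht ?_
    rw [hlift s (Ioo_subset_Icc_self hs), hlift t (Ioo_subset_Icc_self ht), hst]
  have himage : f '' openSide N k = γ.toFun '' (φ '' Ioo 0 1) := by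
    rw [openSide_eq_image, image_image, image_image]
    exact image_congr fun t ht => hlift t (Ioo_subset_Icc_self ht)
  have hγinj : InjOn γ.toFun (φ '' Ioo 0 1) := by
    rintro _ ⟨s, hs, rfl⟩ _ ⟨t, ht, rfl⟩ hst
    rw [hsinj hs ht]
    rw [hlift s (Ioo_subset_Icc_self hs), hlift t (Ioo_subset_Icc_self ht)]
    exact hst
  rw [himage] at hA
  have hoff : ∀ t ∈ Ioo (0 : ℝ) 1, γ (φ t) ∉ δ.image := fun t ht => by
    rw [← hlift t (Ioo_subset_Icc_self ht)]
    exact (hIoo t ht).2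
  have hderiv : ∀ t ∈ Icc (0 : ℝ) 1, DifferentiableWithinAt ℝ φ (Icc 0 1) t ∧
      tangentWithin f (polygon N) (sidePoint N k t) (edge N k)
        = derivWithin φ (Icc 0 1) t • γ.velocity (φ t) := by
    intro t ht
    have h1 : HasMFDerivWithinAt 𝓘(ℝ, ℝ) 𝓘(ℝ, ℂ) (sidePoint N k) (Icc 0 1) t
        (ContinuousLinearMap.toSpanSingleton ℝ (edge N k)) :=
      (hasDerivAt_sidePoint N k t).hasFDerivAt.hasFDerivWithinAt.hasMFDerivWithinAt
    have h2 := (hasMFDerivWithinAt_tangentWithin hf (hmaps ht)).comp t h1 hmaps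
    have h3 := h2.congr_of_eventuallyEq (f₁ := γ.toFun ∘ φ)
      (by filter_upwards [self_mem_nhdsWithin] with s hs using (hlift s hs).symm) (hlift t ht).symm
    have hd := γ.differentiableWithinAt_of_comp hφ.continuousWithinAt h3
    refine ⟨hd, ?_⟩
    have h4 : HasMFDerivWithinAt 𝓘(ℝ, ℝ) 𝓘(ℝ, ℝ) φ (Icc 0 1) t
        (ContinuousLinearMap.toSpanSingleton ℝ (derivWithin φ (Icc 0 1) t)) :=
      hd.hasDerivWithinAt.hasFDerivWithinAt.hasMFDerivWithinAt
    have h5 := (γ.hasMFDerivAt (φ t)).comp_hasMFDerivWithinAt t h4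
    have h6 := UniqueMDiffWithinAt.eq
      (uniqueDiffOn_Icc (zero_lt_one' ℝ) t ht).uniqueMDiffWithinAt h3 h5
    have h7 : tangentWithin f (polygon N) (sidePoint N k t)
        (ContinuousLinearMap.toSpanSingleton ℝ (edge N k) (1 : ℝ)) = γ.tangentMap (φ t)
        (ContinuousLinearMap.toSpanSingleton ℝ (derivWithin φ (Icc 0 1) t) (1 : ℝ)) :=
      congrArg (fun A : ℝ →L[ℝ] Plane => A 1) h6
    simpa [SimpleClosedCurve.tangentMap_apply] using h7
  -- The polygon map has injective derivative up to the corners, so the speed of the lift never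
  -- vanishes and its sign is that of the monotonicity.
  have hne : ∀ t ∈ Icc (0 : ℝ) 1, derivWithin φ (Icc 0 1) t ≠ 0 := by
    intro t ht h
    have := (hderiv t ht).2
    rw [h, zero_smul] at this
    exact edge_ne_zero hN k (hreg _ (hmaps ht) (this.trans (map_zero _).symm))
  rcases strictMonoOn_Icc_or_strictAntiOn_Icc hφ hφinj with hm | hm
  · have hlt := hm (left_mem_Icc.2 zero_le_one) (right_mem_Icc.2 zero_le_one) one_pos
    have hI : φ '' Ioo 0 1 = Ioo (φ 0) (φ 1) :=
      hφ.continuousOn.image_Ioo_of_strictMonoOn zero_le_one hm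
    rw [hI] at hA hγinj
    obtain ⟨h1, h2⟩ := SimpleClosedCurve.endpoints_mem_image hlt hγinj hA
    exact ⟨1, φ, hφ, hlift, .inl ⟨rfl, hm⟩, h1, h2, hoff, fun t ht => ⟨_, sign_pos
      (lt_of_le_of_ne hm.monotoneOn.derivWithin_nonneg (hne t ht).symm), (hderiv t ht).2⟩⟩
  · have hlt := hm (left_mem_Icc.2 zero_le_one) (right_mem_Icc.2 zero_le_one) one_pos
    have hI : φ '' Ioo 0 1 = Ioo (φ 1) (φ 0) :=
      hφ.continuousOn.image_Ioo_of_strictAntiOn zero_le_one hm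
    rw [hI] at hA hγinj
    obtain ⟨h1, h2⟩ := SimpleClosedCurve.endpoints_mem_image hlt hγinj hA
    exact ⟨-1, φ, hφ, hlift, .inr ⟨rfl, hm⟩, h2, h1, hoff, fun t ht => ⟨_, sign_neg
      (lt_of_le_of_ne hm.antitoneOn.derivWithin_nonpos (hne t ht)), (hderiv t ht).2⟩⟩

end FillingPairs

/-! ### Crossing signs and corners -/

namespace FillingPairs

open Set Filter Topology

universe u
variable {S : Type u} [TopologicalSpace S] [ChartedSpace Plane S]

lemma eq_one_of_sum_eq_card {ι : Type*} (s : Finset ι) (f : ι → SignType)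
    (h : ∑ i ∈ s, (f i : ℤ) = s.card) : ∀ i ∈ s, f i = 1 := by
  have h1 : ∀ a : SignType, 0 ≤ 1 - (a : ℤ) := by decide
  have h2 : ∀ a : SignType, 1 - (a : ℤ) = 0 → a = 1 := by decide
  have h3 : ∑ i ∈ s, (1 - (f i : ℤ)) = 0 := by
    rw [Finset.sum_sub_distrib, h]; simp
  intro i hi
  exact h2 _ ((Finset.sum_eq_zero_iff_of_nonneg fun i _ => h1 (f i)).1 h3 i hi)

lemma exists_eq_of_natAbs_sum_eq_card {ι : Type*} (s : Finset ι) (f : ι → SignType)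
    (h : (∑ i ∈ s, (f i : ℤ)).natAbs = s.card) : ∃ ε, ∀ i ∈ s, f i = ε := by
  rcases Int.natAbs_eq (∑ i ∈ s, (f i : ℤ)) with h1 | h1
  · exact ⟨1, eq_one_of_sum_eq_card s f (by rw [h1, h])⟩
  · refine ⟨-1, fun i hi => ?_⟩
    have h2 := eq_one_of_sum_eq_card s (fun i => -f i) (by
      have hneg : ∀ a : SignType, ((-a : SignType) : ℤ) = -(a : ℤ) := by decide
      simp only [hneg, Finset.sum_neg_distrib]
      rw [h1, h, neg_neg]) i hi
    rw [← h2, neg_neg]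

/-- All crossings of a coherent pair in minimal position have the same sign. -/
lemma exists_crossing_sign {α β : SimpleClosedCurve S} (hpos : MinimalPosition α β)
    (hcoh : IsCoherent α β) : ∃ ε : SignType, ∀ s t : ℝ, α s = β t →
      SignType.sign (det2 (α.velocity s) (β.velocity t)) = ε := by
  set T : Set (ℝ × ℝ) := {p | p.1 ∈ Ico 0 1 ∧ p.2 ∈ Ico 0 1 ∧ α p.1 = β p.2} with hT
  have hfract : ∀ (γ : SimpleClosedCurve S) (t : ℝ),
      γ (Int.fract t) = γ t ∧ γ.velocity (Int.fract t) = γ.velocity t := by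
    intro γ t
    have h : γ (Int.fract t) = γ t := by
      have := γ.apply_add_int (Int.fract t) ⌊t⌋
      rw [Int.fract_add_floor] at this
      exact this.symm
    exact ⟨h, γ.velocity_eq_of_apply_eq h⟩
  have hIco : ∀ t : ℝ, Int.fract t ∈ Ico (0 : ℝ) 1 := fun t =>
    ⟨Int.fract_nonneg t, Int.fract_lt_one t⟩
  have hinj : ∀ (γ : SimpleClosedCurve S), ∀ s ∈ Ico (0 : ℝ) 1, ∀ t ∈ Ico (0 : ℝ) 1,
      γ s = γ t → s = t := by
    intro γ s hs t ht h
    obtain ⟨n, hn⟩ := γ.injective_mod s t h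
    have h1 : (-1 : ℝ) < n := by rw [← hn]; linarith [hs.1, ht.2]
    have h2 : (n : ℝ) < 1 := by rw [← hn]; linarith [hs.2, ht.1]
    have h3 : -1 < n := by exact_mod_cast h1
    have h4 : n < 1 := by exact_mod_cast h2
    have h5 : n = 0 := by omega
    rw [h5, Int.cast_zero] at hn
    linarith
  have himage : (fun p : ℝ × ℝ => α p.1) '' T = α.image ∩ β.image := by
    ext x
    constructor
    · rintro ⟨p, hp, rfl⟩
      exact ⟨α.apply_mem_image _, p.2, hp.2.2.symm⟩
    · rintro ⟨⟨s, rfl⟩, ⟨t, ht⟩⟩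
      refine ⟨(Int.fract s, Int.fract t), ⟨hIco s, hIco t, ?_⟩, (hfract α s).1⟩
      exact (hfract α s).1.trans (ht.symm.trans (hfract β t).1.symm)
  have hTinj : InjOn (fun p : ℝ × ℝ => α p.1) T := by
    intro p hp q hq hpq
    refine Prod.ext (hinj α _ hp.1 _ hq.1 hpq) (hinj β _ hp.2.1 _ hq.2.1 ?_)
    rw [← hp.2.2, ← hq.2.2]
    exact hpq
  have hcard : ((algInt α β).natAbs : ℕ∞) = T.encard := by
    rw [hcoh, ← hpos.2, ← himage, hTinj.encard_image]
  -- Coherence makes the number of crossings equal to a natural number, so the `finsum` in `algInt`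
  -- is an honest finite sum.
  have hfin : T.Finite := by
    rw [← Set.encard_ne_top_iff, ← hcard]
    exact ENat.natCast_ne_top _
  have hsum : algInt α β = ∑ p ∈ hfin.toFinset,
      (SignType.sign (det2 (α.velocity p.1) (β.velocity p.2)) : ℤ) := by
    rw [algInt, ← finsum_mem_eq_finite_toFinset_sum]
  rw [hsum, hfin.encard_eq_coe_toFinset_card] at hcard
  obtain ⟨ε, hε⟩ := exists_eq_of_natAbs_sum_eq_card hfin.toFinset
    (fun p => SignType.sign (det2 (α.velocity p.1) (β.velocity p.2))) (by exact_mod_cast hcard)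
  refine ⟨ε, fun s t hst => ?_⟩
  have := hε (Int.fract s, Int.fract t) (hfin.mem_toFinset.2 ⟨hIco s, hIco t, by
    rw [(hfract α s).1, (hfract β t).1, hst]⟩)
  simpa only [(hfract α s).2, (hfract β t).2] using this

lemma exists_sidePoint_mem_image {S : Type*} (f : ℂ → S) (N k : ℕ) :
    ∃ s ∈ Ioo (0 : ℝ) 1, f (sidePoint N k s) ∈ f '' openSide N k := by
  refine ⟨1 / 2, by norm_num, mem_image_of_mem _ ?_⟩
  rw [openSide_eq_image]
  exact mem_image_of_mem _ (by norm_num)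

namespace IsSideLift

variable {f : ℂ → S} {γ δ γ' δ' : SimpleClosedCurve S} {N k l : ℕ} {σ σ' : SignType} {φ φ' : ℝ → ℝ}

lemma ne_zero (h : IsSideLift f γ δ N k σ φ) : σ ≠ 0 := by
  rcases h.mono with ⟨h, -⟩ | ⟨h, -⟩ <;> rw [h] <;> decide

/-- The directions of two consecutive sides, the sign of the crossing at their common corner and the
orientation of the polygon determine each other. -/
lemma mul_sign_det2 (hN : 3 ≤ N) (h : IsSideLift f γ δ N k σ φ)
    (h' : IsSideLift f γ' δ' N (k + 1) σ' φ') :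
    γ (φ 1) = γ' (φ' 0) ∧
    σ * σ' * SignType.sign (det2 (γ.velocity (φ 1)) (γ'.velocity (φ' 0))) =
      -SignType.sign (jac (tangentWithin f (polygon N) (vertex N (k + 1)))) := by
  have e1 := h.eq 1 (right_mem_Icc.2 zero_le_one)
  have e2 := h'.eq 0 (left_mem_Icc.2 zero_le_one)
  obtain ⟨c, hc, hcv⟩ := h.deriv 1 (right_mem_Icc.2 zero_le_one)
  obtain ⟨d, hd, hdv⟩ := h'.deriv 0 (left_mem_Icc.2 zero_le_one)
  rw [sidePoint_one] at e1 hcv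
  rw [sidePoint_zero] at e2 hdv
  refine ⟨e1.symm.trans e2, ?_⟩
  have := det2_map (tangentWithin f (polygon N) (vertex N (k + 1))) (edge N k) (edge N (k + 1))
  rw [hcv, hdv, det2_smul_left, det2_smul_right, ← mul_assoc] at this
  have h2 := congrArg SignType.sign this
  rw [sign_mul, sign_mul, sign_mul, sign_neg (cross_edge_neg hN k), hc, hd] at h2
  rw [h2, mul_neg_one]

/-- At a common point both edge vectors map to multiples of the same velocity, and
`mul_nonpos_of_edge_parallel` forbids multiples of the same sign. -/
lemma eq_neg_of_image_eq [IsManifold (𝓡 2) 1 S] [HasOrientedAtlas S] (hN : 3 ≤ N)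
    (h0 : (0 : ℂ) ∈ interior (polygon N))
    (hf : ContMDiffOn 𝓘(ℝ, ℂ) (𝓡 2) 1 f (polygon N))
    (hreg : ∀ z ∈ polygon N, Function.Injective (tangentWithin f (polygon N) z))
    (hinj : InjOn f (interior (polygon N))) (hkl : k % N ≠ l % N)
    (h : IsSideLift f γ δ N k σ φ) (h' : IsSideLift f γ δ' N l σ' φ')
    (himage : f '' openSide N k = f '' openSide N l) : σ' = -σ := by
  obtain ⟨s, hs, hsmem⟩ := exists_sidePoint_mem_image f N k
  rw [himage, openSide_eq_image, image_image] at hsmem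
  obtain ⟨t, ht, hts⟩ := hsmem
  obtain ⟨c, hc, hcv⟩ := h.deriv s (Ioo_subset_Icc_self hs)
  obtain ⟨d, hd, hdv⟩ := h'.deriv t (Ioo_subset_Icc_self ht)
  have hv : γ.velocity (φ s) = γ.velocity (φ' t) := by
    apply γ.velocity_eq_of_apply_eq
    rw [← h.eq s (Ioo_subset_Icc_self hs), ← h'.eq t (Ioo_subset_Icc_self ht)]
    exact hts.symm
  rw [← hv] at hdv
  have hcd := mul_nonpos_of_edge_parallel hN h0 hf hreg hinj hkl hs ht hts.symm hcv hdv
  have h1 := h.ne_zero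
  have h2 := h'.ne_zero
  have h3 : SignType.sign (c * d) ≠ 1 := fun h => (sign_eq_one_iff.1 h).not_ge hcd
  rw [sign_mul, hc, hd] at h3
  revert h1 h2 h3
  clear * -
  revert σ σ'
  decide

/-- If two sides run in opposite directions along the same subarc, then the second one starts where
the first one ends. -/
lemma apply_one_eq_apply_zero (h : IsSideLift f γ δ N k σ φ) (h' : IsSideLift f γ δ N l (-σ) φ')
    (himage : f '' openSide N k = f '' openSide N l) : γ (φ 1) = γ (φ' 0) := by
  obtain ⟨s, hs, hsmem⟩ := exists_sidePoint_mem_image f N k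
  rw [himage, openSide_eq_image, image_image] at hsmem
  obtain ⟨t, ht, hts⟩ := hsmem
  have hst : γ (φ s) = γ (φ' t) := by
    rw [← h.eq s (Ioo_subset_Icc_self hs), ← h'.eq t (Ioo_subset_Icc_self ht)]
    exact hts.symm
  have m0 : (0 : ℝ) ∈ Icc (0 : ℝ) 1 := left_mem_Icc.2 zero_le_one
  have m1 : (1 : ℝ) ∈ Icc (0 : ℝ) 1 := right_mem_Icc.2 zero_le_one
  have ms := Ioo_subset_Icc_self hs
  have mt := Ioo_subset_Icc_self ht
  have hoff : ∀ r ∈ φ '' Ioo 0 1, γ r ∉ δ.image := by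
    rintro _ ⟨r, hr, rfl⟩; exact h.off r hr
  have hoff' : ∀ r ∈ φ' '' Ioo 0 1, γ r ∉ δ.image := by
    rintro _ ⟨r, hr, rfl⟩; exact h'.off r hr
  rcases h.mono with ⟨hσ, hm⟩ | ⟨hσ, hm⟩ <;> rcases h'.mono with ⟨hσ', hm'⟩ | ⟨hσ', hm'⟩
  · rw [hσ] at hσ'; exact absurd hσ' (by decide)
  · rw [h.continuous.continuousOn.image_Ioo_of_strictMonoOn zero_le_one hm] at hoff
    rw [h'.continuous.continuousOn.image_Ioo_of_strictAntiOn zero_le_one hm'] at hoff'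
    exact (SimpleClosedCurve.endpoints_eq h.start h.finish h'.finish h'.start hoff hoff'
      ⟨hm m0 ms hs.1, hm ms m1 hs.2⟩ ⟨hm' mt m1 ht.2, hm' m0 mt ht.1⟩ hst).2
  · rw [h.continuous.continuousOn.image_Ioo_of_strictAntiOn zero_le_one hm] at hoff
    rw [h'.continuous.continuousOn.image_Ioo_of_strictMonoOn zero_le_one hm'] at hoff'
    exact (SimpleClosedCurve.endpoints_eq h.finish h.start h'.start h'.finish hoff hoff'
      ⟨hm ms m1 hs.2, hm m0 ms hs.1⟩ ⟨hm' m0 mt ht.1, hm' mt m1 ht.2⟩ hst).1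
  · rw [hσ] at hσ'; exact absurd hσ' (by decide)

/-- A side with the same start and end covers all of the curve except that point. -/
lemma diff_subset_image (h : IsSideLift f γ δ N k σ φ) (heq : γ (φ 0) = γ (φ 1)) :
    γ.image \ δ.image ⊆ f '' openSide N k := by
  have himage : f '' openSide N k = γ.toFun '' (φ '' Ioo 0 1) := by
    rw [openSide_eq_image, image_image, image_image]
    exact image_congr fun t ht => h.eq t (Ioo_subset_Icc_self ht)
  have m0 : (0 : ℝ) ∈ Icc (0 : ℝ) 1 := left_mem_Icc.2 zero_le_one
  have m1 : (1 : ℝ) ∈ Icc (0 : ℝ) 1 := right_mem_Icc.2 zero_le_one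
  -- Equal end points force `b - a` to be a positive integer, so the interval contains a full
  -- period; only `γ a`, a point of `δ`, may be missed.
  have key : ∀ a b : ℝ, a < b → γ a ∈ δ.image → γ a = γ b →
      γ.image \ δ.image ⊆ γ.toFun '' Ioo a b := by
    rintro a b hab ha hγ _ ⟨⟨t, rfl⟩, ht⟩
    obtain ⟨n, hn⟩ := γ.injective_mod b a hγ.symm
    have hn1 : (0 : ℝ) < n := by rw [← hn]; linarith
    have hn2 : (1 : ℝ) ≤ n := by exact_mod_cast Int.cast_pos.1 hn1
    have e : γ (a + Int.fract (t - a)) = γ t := by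
      have := γ.apply_add_int (a + Int.fract (t - a)) ⌊t - a⌋
      rw [add_assoc, Int.fract_add_floor, add_sub_cancel] at this
      exact this.symm
    refine ⟨a + Int.fract (t - a), ⟨?_, ?_⟩, e⟩
    · refine lt_of_le_of_ne (by linarith [Int.fract_nonneg (t - a)]) fun hc => ht ?_
      rw [← hc] at e
      exact e ▸ ha
    · linarith [Int.fract_lt_one (t - a)]
  rw [himage]
  rcases h.mono with ⟨-, hm⟩ | ⟨-, hm⟩
  · rw [h.continuous.continuousOn.image_Ioo_of_strictMonoOn zero_le_one hm]
    exact key _ _ (hm m0 m1 one_pos) h.start heq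
  · rw [h.continuous.continuousOn.image_Ioo_of_strictAntiOn zero_le_one hm]
    exact key _ _ (hm m0 m1 one_pos) h.finish heq.symm

end IsSideLift

lemma IsSubarc.eq_of_subset {γ δ : SimpleClosedCurve S} {A B : Set S} (hA : IsSubarc γ δ A)
    (hB : IsSubarc γ δ B) (h : B ⊆ A) : A = B := by
  obtain ⟨x, hx, rfl⟩ := hA
  obtain ⟨y, hy, rfl⟩ := hB
  exact connectedComponentIn_eq (h (mem_connectedComponentIn hy))

lemma IsSubarc.subset {γ δ : SimpleClosedCurve S} {A : Set S} (hA : IsSubarc γ δ A) :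
    A ⊆ γ.image \ δ.image := by
  obtain ⟨x, -, rfl⟩ := hA
  exact connectedComponentIn_subset _ _

end FillingPairs

/-! ### Alternation of sides and parity of identifications -/

namespace FillingPairs

open Set Filter Topology

universe u
variable {S : Type u} [TopologicalSpace S] [ChartedSpace Plane S]

namespace CutPolygon

variable {α β : SimpleClosedCurve S} {N : ℕ}

/-- The same polygon for the two curves in the other order. -/
def swap (P : CutPolygon α β N) : CutPolygon β α N where
  toFun := P.toFun
  contMDiffOn := P.contMDiffOn
  regular := P.regular
  bijOn_interior := by rw [union_comm]; exact P.bijOn_interior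
  injOn_side := P.injOn_side
  side_subarc k := (P.side_subarc k).symm

variable (P : CutPolygon α β N)

lemma injective_tangentWithin (z : ℂ) (hz : z ∈ polygon N) :
    Function.Injective (tangentWithin P.toFun (polygon N) z) := P.regular z hz

/-- The `k`-th side, with `k` taken modulo `N`, is glued to a subarc of the first curve. -/
def IsFirst (k : ℕ) : Prop := IsSubarc α β (P.toFun '' openSide N k)

lemma isAlphaEdge_iff (k : Fin N) : P.IsAlphaEdge k ↔ P.IsFirst k := Iff.rfl

variable {P}

lemma isFirst_or_isFirst_swap (hN : 3 ≤ N) (k : ℕ) : P.IsFirst k ∨ P.swap.IsFirst k := by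
  have := P.side_subarc ⟨k % N, Nat.mod_lt k (by omega)⟩
  rw [side_eq_openSide, openSide_mod (by omega)] at this
  exact this

lemma exists_lift [T2Space S] [IsManifold (𝓡 2) 1 S] (hN : 3 ≤ N) {k : ℕ} (hk : P.IsFirst k) :
    ∃ σ φ, IsSideLift P.toFun α β N k σ φ := by
  refine exists_isSideLift hN P.contMDiffOn P.injective_tangentWithin ?_ hk
  have := P.injOn_side ⟨k % N, Nat.mod_lt k (by omega)⟩
  rwa [side_eq_openSide, openSide_mod (by omega)] at this

/-- Two sides on one curve meeting at a corner would have parallel images of their edge vectors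
there, but those vectors are independent and the derivative is injective. -/
lemma not_isFirst_succ [T2Space S] [IsManifold (𝓡 2) 1 S] (hN : 3 ≤ N) {k : ℕ}
    (hk : P.IsFirst k) : ¬ P.IsFirst (k + 1) := by
  intro hk'
  obtain ⟨σ, φ, h⟩ := exists_lift hN hk
  obtain ⟨σ', φ', h'⟩ := exists_lift hN hk'
  obtain ⟨h1, h2⟩ := h.mul_sign_det2 hN h'
  rw [α.velocity_eq_of_apply_eq h1] at h2
  have h3 : det2 (α.velocity (φ' 0)) (α.velocity (φ' 0)) = 0 := by simp [det2]; ring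
  rw [h3, sign_zero, mul_zero, eq_comm] at h2
  have hneg : ∀ σ : SignType, -σ = 0 → σ = 0 := by decide
  exact jac_ne_zero (P.injective_tangentWithin _ (vertex_mem_polygon _))
    (sign_eq_zero_iff.1 (hneg _ h2))

lemma isFirst_swap_succ [T2Space S] [IsManifold (𝓡 2) 1 S] (hN : 3 ≤ N) {k : ℕ}
    (hk : P.IsFirst k) : P.swap.IsFirst (k + 1) :=
  (isFirst_or_isFirst_swap hN (k + 1)).resolve_left (not_isFirst_succ hN hk)

lemma isFirst_add_two [T2Space S] [IsManifold (𝓡 2) 1 S] (hN : 3 ≤ N) {k : ℕ}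
    (hk : P.IsFirst k) : P.IsFirst (k + 2) :=
  isFirst_swap_succ (P := P.swap) hN (isFirst_swap_succ hN hk)

variable [T2Space S] [IsManifold (𝓡 2) 1 S] [HasOrientedAtlas S]

/-- If all crossings have the same sign, then the sides on the same curve run alternately forwards
and backwards. -/
lemma direction_add_two (hN : 3 ≤ N) (h0 : (0 : ℂ) ∈ interior (polygon N)) {ε : SignType}
    (hε : ∀ s t : ℝ, α s = β t → SignType.sign (det2 (α.velocity s) (β.velocity t)) = ε) {k : ℕ}
    {σ σ' : SignType} {φ φ' : ℝ → ℝ} (h : IsSideLift P.toFun α β N k σ φ)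
    (h' : IsSideLift P.toFun α β N (k + 2) σ' φ') (hk : P.IsFirst k) : σ' = -σ := by
  obtain ⟨τ, ψ, hτ⟩ := exists_lift hN (isFirst_swap_succ hN hk)
  obtain ⟨e1, e2⟩ := h.mul_sign_det2 hN hτ
  obtain ⟨e3, e4⟩ := hτ.mul_sign_det2 hN h'
  rw [hε _ _ e1] at e2
  rw [det2_swap, Left.sign_neg, hε _ _ e3.symm] at e4
  -- The crossing sign is `ε` at the first corner and `-ε` at the second, where the curves come in
  -- the other order; the orientation sign is the same at both.
  have hJ := sign_jac_tangentWithin_eq (convex_polygon N) ⟨0, h0⟩ P.contMDiffOn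
    P.injective_tangentWithin (vertex_mem_polygon (N := N) (k + 1))
    (vertex_mem_polygon (N := N) (k + 1 + 1))
  have hne : SignType.sign (jac (tangentWithin P.toFun (polygon N) (vertex N (k + 1)))) ≠ 0 :=
    sign_ne_zero.2 (jac_ne_zero (P.injective_tangentWithin _ (vertex_mem_polygon _)))
  change τ * σ' * -ε = -SignType.sign (jac (tangentWithin P.toFun (polygon N) _)) at e4
  rw [← hJ] at e4
  generalize SignType.sign (jac (tangentWithin P.toFun (polygon N) (vertex N (k + 1)))) = j at *
  clear * - e2 hne e4
  revert σ σ' τ ε j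
  decide

lemma direction_add_two_mul (hN : 3 ≤ N) (h0 : (0 : ℂ) ∈ interior (polygon N)) {ε : SignType}
    (hε : ∀ s t : ℝ, α s = β t → SignType.sign (det2 (α.velocity s) (β.velocity t)) = ε) {k : ℕ}
    {σ : SignType} {φ : ℝ → ℝ} (h : IsSideLift P.toFun α β N k σ φ) (hk : P.IsFirst k) (i : ℕ) :
    P.IsFirst (k + 2 * i) ∧
      ∃ φ', IsSideLift P.toFun α β N (k + 2 * i) (if Even i then σ else -σ) φ' := by
  induction i with
  | zero => exact ⟨hk, φ, by simpa using h⟩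
  | succ i ih =>
    obtain ⟨ih1, φ', ih2⟩ := ih
    have hi : P.IsFirst (k + 2 * (i + 1)) := isFirst_add_two hN ih1
    obtain ⟨σ', ψ, hψ⟩ := exists_lift hN hi
    have e := direction_add_two hN h0 hε ih2 hψ ih1
    refine ⟨hi, ψ, ?_⟩
    rw [e] at hψ
    convert hψ using 1
    by_cases h : Even i <;> simp [Nat.even_add_one, h]

/-- Identified sides of a coherent pair are separated by an odd number of steps along the sides of
the same curve. -/
lemma odd_add_of_image_eq (hN : 3 ≤ N) (h0 : (0 : ℂ) ∈ interior (polygon N)) {ε : SignType}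
    (hε : ∀ s t : ℝ, α s = β t → SignType.sign (det2 (α.velocity s) (β.velocity t)) = ε)
    {k i j : ℕ} (hk : P.IsFirst k) (hij : (k + 2 * i) % N ≠ (k + 2 * j) % N)
    (himage : P.toFun '' openSide N (k + 2 * i) = P.toFun '' openSide N (k + 2 * j)) :
    Odd (i + j) := by
  obtain ⟨σ, φ, h⟩ := exists_lift hN hk
  obtain ⟨-, φ₁, h1⟩ := direction_add_two_mul hN h0 hε h hk i
  obtain ⟨-, φ₂, h2⟩ := direction_add_two_mul hN h0 hε h hk j
  have hσ := h.ne_zero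
  have := h1.eq_neg_of_image_eq hN h0 P.contMDiffOn P.injective_tangentWithin
    P.bijOn_interior.injOn hij h2 himage
  have hneg : ∀ σ : SignType, σ ≠ 0 → σ ≠ -σ := by decide
  rw [← Nat.not_even_iff_odd, Nat.even_add]
  by_cases hi : Even i <;> by_cases hj : Even j <;> simp_all [hneg σ hσ]

/-- Two consecutive sides on the same curve are not identified. -/
lemma image_ne_image_add_two (hN : 5 ≤ N) (h0 : (0 : ℂ) ∈ interior (polygon N)) {ε : SignType}
    (hε : ∀ s t : ℝ, α s = β t → SignType.sign (det2 (α.velocity s) (β.velocity t)) = ε)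
    {k : ℕ} (hk : P.IsFirst k) :
    P.toFun '' openSide N k ≠ P.toFun '' openSide N (k + 2) := by
  intro himage
  have hN' : 3 ≤ N := by omega
  obtain ⟨σ, φ, h⟩ := exists_lift hN' hk
  obtain ⟨σ', φ', h'⟩ := exists_lift hN' (isFirst_add_two hN' hk)
  have hkl : k % N ≠ (k + 2) % N := by
    intro h
    have := (Nat.modEq_iff_dvd' (by omega)).1 (show k ≡ k + 2 [MOD N] from h)
    have := Nat.le_of_dvd (by omega) this
    omega
  have hopp := h.eq_neg_of_image_eq hN' h0 P.contMDiffOn P.injective_tangentWithin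
    P.bijOn_interior.injOn hkl h' himage
  rw [hopp] at h'
  have hk1 : P.swap.IsFirst (k + 1) := isFirst_swap_succ hN' hk
  obtain ⟨τ, ψ, hψ⟩ := exists_lift hN' hk1
  -- The `β`-side in between starts where side `k` ends and ends where side `k + 2` starts, which is
  -- the same point of the surface.
  have hends : β (ψ 0) = β (ψ 1) :=
    ((h.mul_sign_det2 hN' hψ).1.symm.trans (h.apply_one_eq_apply_zero h' himage)).trans
      (hψ.mul_sign_det2 hN' h').1.symm
  have hε' : ∀ s t : ℝ, β s = α t →
      SignType.sign (det2 (β.velocity s) (α.velocity t)) = -ε := by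
    intro s t hst
    rw [det2_swap, Left.sign_neg, hε t s hst.symm]
  -- Side `k + 5` is two `β`-steps after side `k + 1`, an even number, and differs from it since `N
  -- ≥ 5`.
  have hk5 : P.swap.IsFirst (k + 1 + 2 * 2) :=
    (direction_add_two_mul hN' h0 hε' hψ hk1 2).1
  have himage' : P.swap.toFun '' openSide N (k + 1 + 2 * 0)
      = P.swap.toFun '' openSide N (k + 1 + 2 * 2) :=
    IsSubarc.eq_of_subset hk1 hk5 (hk5.subset.trans (hψ.diff_subset_image hends))
  have hodd := odd_add_of_image_eq hN' h0 hε' hk1 (i := 0) (j := 2) (by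
    intro h
    have := (Nat.modEq_iff_dvd' (by omega)).1 (show k + 1 + 2 * 0 ≡ k + 1 + 2 * 2 [MOD N] from h)
    have := Nat.le_of_dvd (by omega) this
    omega) himage'
  exact absurd hodd (by decide)

end CutPolygon

/-! ### From polygon sides to indices of `α`-edges -/

lemma odd_cyclicDist {n : ℕ} {i j : Fin (2 * n)} (h : Odd ((i : ℕ) + j)) :
    Odd (cyclicDist n i j) := by
  rw [Nat.odd_iff] at h ⊢
  unfold cyclicDist
  split_ifs <;> omega

lemma cyclicDist_eq_one {n : ℕ} {i j : Fin (2 * n)} (h : cyclicDist n i j = 1) :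
    (i : ℕ) + 1 = j ∨ (j : ℕ) + 1 = i ∨ (i : ℕ) = 0 ∧ (j : ℕ) + 1 = 2 * n ∨
      (j : ℕ) = 0 ∧ (i : ℕ) + 1 = 2 * n := by
  unfold cyclicDist at h
  split_ifs at h <;> omega

/-- The increasing enumeration of the sides on the first curve takes every second side. -/
lemma CutPolygon.exists_eq_add_two_mul [T2Space S] [IsManifold (𝓡 2) 1 S]
    {α β : SimpleClosedCurve S} {n : ℕ} (hn : 0 < n) {P : CutPolygon α β (4 * n)}
    {a : Fin (2 * n) → Fin (4 * n)} (ha : StrictMono a)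
    (ha' : ∀ k, k ∈ range a ↔ P.IsAlphaEdge k) :
    ∃ c : ℕ, P.IsFirst c ∧ ∀ i, (a i : ℕ) = c + 2 * i := by
  have hN : 3 ≤ 4 * n := by omega
  obtain ⟨c, hc2, hc, hiff⟩ : ∃ c < 2, P.IsFirst c ∧ ∀ k, P.IsFirst k ↔ k % 2 = c := by
    have hsucc : ∀ k, P.IsFirst (k + 1) ↔ ¬ P.IsFirst k := fun k =>
      ⟨fun h h' => not_isFirst_succ hN h' h, fun h => isFirst_swap_succ (P := P.swap) hN
        ((isFirst_or_isFirst_swap hN k).resolve_left h)⟩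
    by_cases h0 : P.IsFirst 0
    · refine ⟨0, by norm_num, h0, fun k => ?_⟩
      induction k with
      | zero => simp [h0]
      | succ k ih => rw [hsucc, ih]; omega
    · refine ⟨1, by norm_num, (hsucc 0).2 h0, fun k => ?_⟩
      induction k with
      | zero => simp [h0]
      | succ k ih => rw [hsucc, ih]; omega
  refine ⟨c, hc, fun i => ?_⟩
  let b : Fin (2 * n) → Fin (4 * n) := fun i => ⟨c + 2 * i, by omega⟩
  have hb : StrictMono b := fun i j hij => by
    have : (i : ℕ) < j := hij
    show c + 2 * (i : ℕ) < c + 2 * (j : ℕ)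
    omega
  -- A strictly increasing enumeration is determined by its range, here a residue class modulo 2.
  have hab : a = b := by
    refine (ha.range_inj hb).1 ?_
    ext k
    rw [ha', P.isAlphaEdge_iff, hiff]
    constructor
    · intro hk
      refine ⟨⟨k / 2, by omega⟩, Fin.ext ?_⟩
      show c + 2 * ((k : ℕ) / 2) = k
      omega
    · rintro ⟨i, rfl⟩
      show (c + 2 * (i : ℕ)) % 2 = c
      omega
  rw [hab]

/-- In a polygon of a pair of curves whose crossings all have the same sign, identified sides on the
first curve have odd cyclic distance different from `1`. -/
lemma CutPolygon.odd_cyclicDist_and_ne_one [T2Space S] [IsManifold (𝓡 2) 1 S] [HasOrientedAtlas S]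
    {α β : SimpleClosedCurve S} {ε : SignType}
    (hε : ∀ s t : ℝ, α s = β t → SignType.sign (det2 (α.velocity s) (β.velocity t)) = ε)
    {n : ℕ} (hn : 2 ≤ n) {P : CutPolygon α β (4 * n)}
    {a : Fin (2 * n) → Fin (4 * n)} (ha : StrictMono a)
    (ha' : ∀ k, k ∈ range a ↔ P.IsAlphaEdge k) {i j : Fin (2 * n)}
    (hij : P.Identified (a i) (a j)) : Odd (cyclicDist n i j) ∧ cyclicDist n i j ≠ 1 := by
  have h0 : (0 : ℂ) ∈ interior (polygon (4 * n)) := zero_mem_interior_polygon (by omega)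
  obtain ⟨c, hc, hac⟩ := CutPolygon.exists_eq_add_two_mul (by omega) ha ha'
  obtain ⟨hne, himage⟩ := hij
  rw [side_eq_openSide, side_eq_openSide, hac, hac] at himage
  have hmod : (c + 2 * (i : ℕ)) % (4 * n) ≠ (c + 2 * (j : ℕ)) % (4 * n) := by
    rw [← hac, ← hac, Nat.mod_eq_of_lt (a i).2, Nat.mod_eq_of_lt (a j).2]
    exact fun h => hne (Fin.ext h)
  refine ⟨odd_cyclicDist (CutPolygon.odd_add_of_image_eq (by omega) h0 hε hc hmod himage),
    fun h1 => ?_⟩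
  have hnext : ∀ l m : Fin (2 * n), (l : ℕ) + 1 = m ∨ (m : ℕ) = 0 ∧ (l : ℕ) + 1 = 2 * n →
      P.toFun '' openSide (4 * n) (c + 2 * l) ≠ P.toFun '' openSide (4 * n) (c + 2 * m) := by
    intro l m hlm
    have hl : P.IsFirst (c + 2 * l) := by
      rw [← hac]
      exact (ha' _).1 ⟨l, rfl⟩
    have e : openSide (4 * n) (c + 2 * m) = openSide (4 * n) (c + 2 * l + 2) := by
      rw [← openSide_mod (by omega) (c + 2 * (m : ℕ)), ← openSide_mod (by omega) (c + 2 * l + 2)]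
      congr 1
      rcases hlm with h | ⟨h, h'⟩
      · rw [← h]; ring_nf
      -- The successor of the last edge is the first one, a full turn of `4 * n` sides later.
      · rw [h, show c + 2 * (l : ℕ) + 2 = c + 2 * 0 + 4 * n by omega, Nat.add_mod_right]
    rw [e]
    exact CutPolygon.image_ne_image_add_two (by omega) h0 hε hl
  rcases cyclicDist_eq_one h1 with h | h | h | h
  · exact hnext i j (.inl h) himage
  · exact hnext j i (.inl h) himage.symm
  · exact hnext j i (.inr h) himage.symm
  · exact hnext i j (.inr h) himage

end FillingPairs

theorem lemma6 {S : Type*} [TopologicalSpace S] [T2Space S] [CompactSpace S] [ConnectedSpace S]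
    [ChartedSpace FillingPairs.Plane S] [IsManifold (𝓡 2) ∞ S] [FillingPairs.HasOrientedAtlas S]
    (g : ℕ) (hg : 3 ≤ g) (hS : FillingPairs.HasGenus S g)
    (α β : FillingPairs.SimpleClosedCurve S)
    (hmin : FillingPairs.IsMinimallyIntersecting α β) (hcoh : FillingPairs.IsCoherent α β)
    -- the `4(2g-1)`-gon of the pair
    (P : FillingPairs.CutPolygon α β (4 * (2 * g - 1)))
    -- its `α`-edges, in clockwise order
    (a : Fin (2 * (2 * g - 1)) → Fin (4 * (2 * g - 1))) (ha : StrictMono a)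
    (ha' : ∀ k, k ∈ Set.range a ↔ P.IsAlphaEdge k)
    (i j : Fin (2 * (2 * g - 1))) (hij : P.Identified (a i) (a j)) :
    Odd (FillingPairs.cyclicDist (2 * g - 1) i j) ∧
      FillingPairs.cyclicDist (2 * g - 1) i j ≠ 1 := by
  have : IsManifold (𝓡 2) 1 S := IsManifold.of_le (n := ∞) (by simp)
  obtain ⟨ε, hε⟩ := FillingPairs.exists_crossing_sign hmin.1.1 hcoh
  exact FillingPairs.CutPolygon.odd_cyclicDist_and_ne_one hε (by omega) ha ha' hij
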